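/- Let $n,p\ge 1$, let $G_1,\dots,G_n:\mathbb{R}^p\to\mathbb{R}^p$ be mappings, $Gx:=\frac1n\sum_{i=1}^nG_ix$, and suppose that for some $L>0$ and all $x,y\in\mathbb{R}^p$ $$\frac1n\sum_{i=1}^n\langle G_ix-G_iy,\,x-y\rangle\ \ge\ \frac1L\cdot\frac1n\sum_{i=1}^n\|G_ix-G_iy\|^2 .$$ Let $x^\star$ be any point with $Gx^\star=0$, let $x^0\in\mathbb{R}^p$, and let $b$ be an integer with $1\le b\le\min\{n,16n^{2/3}\}$. Put $$r:=3,\quad \beta:=\frac{b^3}{2L(b^3+64n^2)},\quad \theta_k:=\frac{k}{k+r+2},\quad \gamma_k:=\frac{k}{k+r},\quad \eta_k:=\frac{2\beta(k+r)}{k+r+2}.$$ **Method (SAGA variant).** Let $\mathcal A_k,\mathcal B_k$ $(k\ge0)$ be random subsets of $[n]$, each uniformly distributed over the $b$-element subsets, such that the pairs $(\mathcal A_k,\mathcal B_k)$ are independent over $k$; the dependence between $\mathcal A_k$ and $\mathcal B_k$ is arbitrary (for example $\mathcal A_k=\mathcal B_k$, the standard SAGA scheme with one i.i.d. mini-batch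 per iteration, or $\mathcal A_k$ independent of $\mathcal B_k$). Set $x^{-1}:=x^0$, $\widehat G_i^0:=G_ix^0$, and for $k\ge0$ $$x^{k+1}:=x^k+\theta_k(x^k-x^{k-1})-\eta_k\widetilde S^k,$$ where $\widetilde S^0:=Gx^0-\gamma_0Gx^{-1}$ and, for $k\ge1$, $$\widetilde S^k:=\frac{1-\gamma_k}{n}\sum_{i=1}^n\widehat G_i^k+\frac1b\sum_{i\in\mathcal B_k}\big[G_ix^k-\gamma_kG_ix^{k-1}-(1-\gamma_k)\widehat G_i^k\big],$$ and then $\widehat G_i^{k+1}:=G_ix^k$ if $i\in\mathcal A_k$ and $\widehat G_i^{k+1}:=\widehat G_i^k$ otherwise. **Constants.** With $\rho:=\frac{b}{2n}$, $\Theta:=\frac{2(n-b)(2n+b)+b^2}{nb^2}$, $\hat\Theta:=\frac{2(n-b)(2n+b)}{nb^2}$, let $$\Lambda:=\frac{4\beta\big(\rho-[\rho+(r+1)(\Theta+\hat\Theta)]L\beta\big)}{L\rho(r+1)},\qquad \psi:=\frac{4\beta^2(\Theta+\hat\Theta)}{\rho\Lambda},\qquad C_0:=r(1+3r+8rL^2\beta^2),$$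 $$C_1:=\frac{4r^2(r-1)L^2\beta^2}{r+2}+\Big(\frac2r+\psi\Big)C_0,\qquad C_2:=4r^2L^2\beta^2+\Big[\psi+\frac{2(r+2)^2}{r}\Big]C_0+\frac{4(r+2)^2C_1}{r(r-2)},\qquad C_3:=\frac{(r+2)^2(C_1+C_2)}{2r^2}.$$ **Conclusions.** The step size satisfies $\beta\in\big[\frac1{2L(1+64n^2)},\frac{32}{65L}\big]$, and $\beta\le\frac1{4L}$ if $b\le4n^{2/3}$. Moreover $C_2\le2559$, $C_3\le3636$, the expectations below are finite, for all $k\ge0$ $$\mathbb E\|x^{k+1}-x^k\|^2\le\frac{C_2\|x^0-x^\star\|^2}{(k+r+2)^2},\qquad \mathbb E\|Gx^k\|^2\le\frac{C_3\|x^0-x^\star\|^2}{\beta^2(k+r-1)(k+r+2)},$$ and $$\lim_{k\to\infty}k^2\,\mathbb E\|x^{k+1}-x^k\|^2=0,\qquad \lim_{k\to\infty}k^2\,\mathbb E\|Gx^k\|^2=0 .$$ **Oracle complexity.** With $b$ of order $n^{2/3}$, $\mathcal O\big(n+\frac{n^{2/3}L\|x^0-x^\star\|}{\varepsilon}\big)$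 evaluations of components $G_i$ suffice for $\mathbb E\|Gx^k\|^2\le\varepsilon^2$. Precisely: for every $c>0$ there is a constant $C(c)$, depending on $c$ only, such that in the above setting, if also $b\ge c\,n^{2/3}$, then for every $\varepsilon>0$ there is $K\ge0$ with $\mathbb E\|Gx^k\|^2\le\varepsilon^2$ for all $k\ge K$ and, almost surely, $$n+\sum_{j=1}^{K}\big(|\mathcal A_j\cup\mathcal B_j|+|\mathcal B_j|\big)\ \le\ C(c)\Big(n+\frac{n^{2/3}L\|x^0-x^\star\|}{\varepsilon}\Big),$$ where the left-hand side is the number of evaluations of components $G_i$ in iterations $0,\dots,K$ (it is $n+2bK$ if $\mathcal A_j=\mathcal B_j$). -/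

import Mathlib

namespace VFKM

variable {n p : ℕ}

/-- The finite-sum operator `G x = (1/n) ∑ i, G_i x`. -/
noncomputable def avg (G : Fin n → EuclideanSpace ℝ (Fin p) → EuclideanSpace ℝ (Fin p))
    (x : EuclideanSpace ℝ (Fin p)) : EuclideanSpace ℝ (Fin p) :=
  (1 / (n : ℝ)) • ∑ i, G i x

/-- The averaged co-coercivity condition
`(1/n) ∑ ⟪G_i x - G_i y, x - y⟫ ≥ (1/L) (1/n) ∑ ‖G_i x - G_i y‖²`. -/
def AvgCocoercive (G : Fin n → EuclideanSpace ℝ (Fin p) → EuclideanSpace ℝ (Fin p))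
    (L : ℝ) : Prop :=
  ∀ x y, (1 / (n : ℝ)) * ∑ i, inner ℝ (G i x - G i y) (x - y) ≥
    (1 / L) * ((1 / (n : ℝ)) * ∑ i, ‖G i x - G i y‖ ^ 2)

/-- The SAGA estimator
`((1-γ)/n) ∑ i, T_i + [G_B x - γ G_B x' - (1-γ) T_B]` of `G x - γ G x'`, with batch `B` and
table `T`, where a subscript `B` is the average over `i ∈ B`. -/
noncomputable def sagaEstimator
    (G : Fin n → EuclideanSpace ℝ (Fin p) → EuclideanSpace ℝ (Fin p)) (γ : ℝ)
    (B : Finset (Fin n)) (T : Fin n → EuclideanSpace ℝ (Fin p))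
    (x' x : EuclideanSpace ℝ (Fin p)) : EuclideanSpace ℝ (Fin p) :=
  ((1 - γ) / (n : ℝ)) • ∑ i, T i +
    ((1 / (B.card : ℝ)) • ∑ i ∈ B, G i x - γ • ((1 / (B.card : ℝ)) • ∑ i ∈ B, G i x')
      - (1 - γ) • ((1 / (B.card : ℝ)) • ∑ i ∈ B, T i))

/-- The state at the start of iteration `k`: `prev = x^{k-1}`, `cur = x^k`, and the table
`Ĝ^k` of stored component values. -/
structure State (n p : ℕ) where
  prev : EuclideanSpace ℝ (Fin p)
  cur : EuclideanSpace ℝ (Fin p)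
  table : Fin n → EuclideanSpace ℝ (Fin p)

/-- The accelerated Krasnoselskii-Mann method with the SAGA estimator, along one realization of
the batches. In iteration `k`, the batch `B k` is used in the estimator, with the table `Ĝ^k`;
then the entries `i ∈ A k` of the table are replaced by `G_i x^k`, which gives `Ĝ^{k+1}`.
Standard SAGA is `A = B`. -/
noncomputable def state (G : Fin n → EuclideanSpace ℝ (Fin p) → EuclideanSpace ℝ (Fin p))
    (r β : ℝ) (x0 : EuclideanSpace ℝ (Fin p)) (A B : ℕ → Finset (Fin n)) : ℕ → State n p
  | 0 => { prev := x0, cur := x0, table := fun i => G i x0 }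
  | k + 1 =>
    let s := state G r β x0 A B k
    let θ : ℝ := (k : ℝ) / (k + r + 2)
    let γ : ℝ := (k : ℝ) / (k + r)
    let η : ℝ := 2 * β * (k + r) / (k + r + 2)
    let S := if k = 0 then avg G s.cur - γ • avg G s.prev
      else sagaEstimator G γ (B k) s.table s.prev s.cur
    { prev := s.cur
      cur := s.cur + θ • (s.cur - s.prev) - η • S
      table := fun i => if i ∈ A k then G i s.cur else s.table i }

/-- The iterate `x^k`. -/
noncomputable def iter (G : Fin n → EuclideanSpace ℝ (Fin p) → EuclideanSpace ℝ (Fin p))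
    (r β : ℝ) (x0 : EuclideanSpace ℝ (Fin p)) (A B : ℕ → Finset (Fin n)) (k : ℕ) :
    EuclideanSpace ℝ (Fin p) :=
  (state G r β x0 A B k).cur

/-- The number of evaluations of components `G_i` in iterations `0, …, k`: all `G_i x^0` in
iteration `0`; in iteration `j ≥ 1`, `G_i x^j` for `i ∈ A j ∪ B j` and `G_i x^{j-1}` for
`i ∈ B j`. It is `n + 2 b k` for `A = B` with batches of size `b`. -/
def oracleCalls (A B : ℕ → Finset (Fin n)) (k : ℕ) : ℕ :=
  n + ∑ j ∈ Finset.Icc 1 k, ((A j ∪ B j).card + (B j).card)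

/-- Random mini-batches of size `b`: every `A k` and every `B k` is uniformly distributed over
the `b`-element subsets of `[n]`, and the pairs `(A k, B k)`, `k ≥ 0`, are independent. How
`A k` and `B k` depend on each other is left free; in particular `A = B` is allowed. -/
structure Sampling {Ω : Type*} [MeasurableSpace Ω] (μ : MeasureTheory.Measure Ω) (b : ℕ)
    (A B : ℕ → Ω → Finset (Fin n)) : Prop where
  measurable_A : ∀ k, Measurable (A k)
  measurable_B : ∀ k, Measurable (B k)
  uniform_A : ∀ k, ∀ s : Finset (Fin n), s.card = b →
    μ.real {ω | A k ω = s} = 1 / (n.choose b : ℝ)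
  uniform_B : ∀ k, ∀ s : Finset (Fin n), s.card = b →
    μ.real {ω | B k ω = s} = 1 / (n.choose b : ℝ)
  indep : ProbabilityTheory.iIndepFun (fun k ω => (A k ω, B k ω)) μ

/-! The constants of the rates, in terms of `r`, `L`, `β` and the parameters `ρ`, `Θ`, `Θ'`
of the estimator. -/

noncomputable def cLambda (r L β ρ Θ Θ' : ℝ) : ℝ :=
  4 * β * (ρ - (ρ + (r + 1) * (Θ + Θ')) * L * β) / (L * ρ * (r + 1))

noncomputable def cPsi (r L β ρ Θ Θ' : ℝ) : ℝ :=
  4 * β ^ 2 * (Θ + Θ') / (ρ * cLambda r L β ρ Θ Θ')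

noncomputable def C0 (r L β : ℝ) : ℝ :=
  r * (1 + 3 * r + 8 * r * L ^ 2 * β ^ 2)

noncomputable def C1 (r L β ρ Θ Θ' : ℝ) : ℝ :=
  4 * r ^ 2 * (r - 1) * L ^ 2 * β ^ 2 / (r + 2) + (2 / r + cPsi r L β ρ Θ Θ') * C0 r L β

noncomputable def C2 (r L β ρ Θ Θ' : ℝ) : ℝ :=
  4 * r ^ 2 * L ^ 2 * β ^ 2 + (cPsi r L β ρ Θ Θ' + 2 * (r + 2) ^ 2 / r) * C0 r L β
    + 4 * (r + 2) ^ 2 * C1 r L β ρ Θ Θ' / (r * (r - 2))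

noncomputable def C3 (r L β ρ Θ Θ' : ℝ) : ℝ :=
  (r + 2) ^ 2 * (C1 r L β ρ Θ Θ' + C2 r L β ρ Θ Θ') / (2 * r ^ 2)

/-! The parameters of the SAGA estimator with `n` components and batch size `b`. -/

noncomputable def sagaRho (n b : ℕ) : ℝ := (b : ℝ) / (2 * n)

noncomputable def sagaTheta (n b : ℕ) : ℝ :=
  (2 * ((n : ℝ) - b) * (2 * n + b) + (b : ℝ) ^ 2) / (n * (b : ℝ) ^ 2)

noncomputable def sagaTheta' (n b : ℕ) : ℝ :=
  2 * ((n : ℝ) - b) * (2 * n + b) / (n * (b : ℝ) ^ 2)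

end VFKM

/-! Write h = 2β, X = x^k - x⋆, D = x^k - x^{k-1}, g = Gx^k, g' = Gx^{k-1}, and D', q for the next
increment and D' + h g. Multiplied by k+5, the recursion is linear in these vectors, and the
estimator error enters as one additive term ε of mean zero given the past. The potential `energy`
combines the anchored vector 2X + k(D + h g') with ‖X‖² and k(k+3)‖D‖². In one step (`energy_step`
and `cocoercive_descent`) it loses in expectation a multiple of k(k+3) U_k, where U_k is the
expected mean of ‖G_i x^k - G_i x^{k-1}‖², and 7/8 (k+3) E‖q‖²; it gains at most 6β² E‖ε‖².

The scaled error is the batch deviation of k(G_i x^k - G_i x^{k-1}) + 3(G_i x^k - Ĝ_i^k), so its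
variance is at most (2k² U_k + 18 V_k)/b, with V_k the expected table error. As V_k carries a
bounded weight, only its unweighted sum matters, and the contraction of the table bounds it by
4(n/b)² ∑ U_k (`sum_tableError_le`). The step size makes the descent pay for all of this with β/(8L)
to spare (`noise_coefficient_le`). Hence the expected energy stays below its initial value 4‖x⁰ -
x⋆‖², which gives the O(1/k²) rates with the numbers 100 and 120. The constants `C2` and `C3` enter
only by lying above these numbers (`C2_C3_bounds`).

The batch B_k acts only through the noise and A_k only through the refresh of the table. Each is
averaged with its own marginal law against the past, so their dependence on each other plays no
role.

For the o(1/k²) rates (`rates_of_step`), the telescoped energy also makes k E‖q‖² and k² U_k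
summable. Two further recursions show that k² E‖D‖² and k² E‖q‖² have summable increases and
summable quotients by k, so both tend to 0; and h g = q - D'. -/

namespace VFKM

open Finset MeasureTheory ProbabilityTheory Filter Topology

variable {n p : ℕ}

/-! ### Uniform averages over the `b`-element subsets -/

/-- The mean of `φ` over the `b`-element subsets of `[n]`. -/
noncomputable def batchMean (b : ℕ) (φ : Finset (Fin n) → ℝ) : ℝ :=
  (n.choose b : ℝ)⁻¹ * ∑ s ∈ powersetCard b univ, φ s

lemma batchMean_mono {b : ℕ} {φ ψ : Finset (Fin n) → ℝ} (h : ∀ s, s.card = b → φ s ≤ ψ s) :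
    batchMean b φ ≤ batchMean b ψ := by
  unfold batchMean
  gcongr with s hs
  exact h s (mem_powersetCard.1 hs).2

lemma batchMean_congr {b : ℕ} {φ ψ : Finset (Fin n) → ℝ} (h : ∀ s, s.card = b → φ s = ψ s) :
    batchMean b φ = batchMean b ψ :=
  le_antisymm (batchMean_mono fun s hs => (h s hs).le) (batchMean_mono fun s hs => (h s hs).ge)

lemma batchMean_const {b : ℕ} (hb : b ≤ n) (c : ℝ) :
    batchMean b (fun _ : Finset (Fin n) => c) = c := by
  have : (n.choose b : ℝ) ≠ 0 := by exact_mod_cast (Nat.choose_pos hb).ne'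
  simp [batchMean, this]

lemma batchMean_add {b : ℕ} (φ ψ : Finset (Fin n) → ℝ) :
    batchMean b (fun s => φ s + ψ s) = batchMean b φ + batchMean b ψ := by
  simp [batchMean, sum_add_distrib, mul_add]

lemma batchMean_mul_left {b : ℕ} (c : ℝ) (φ : Finset (Fin n) → ℝ) :
    batchMean b (fun s => c * φ s) = c * batchMean b φ := by
  simp only [batchMean, ← mul_sum]
  ring

lemma card_filter_mem_powersetCard {b : ℕ} (hb : 1 ≤ b) (i : Fin n) :
    ((powersetCard b univ).filter fun s : Finset (Fin n) => i ∈ s).card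
      = (n - 1).choose (b - 1) := by
  have := card_filter_powersetCard_subset {i} (univ : Finset (Fin n)) b (subset_univ _)
    (by simpa using hb)
  simpa using this

lemma choose_pred_div_choose {b : ℕ} (hb : 1 ≤ b) (hbn : b ≤ n) :
    (n.choose b : ℝ)⁻¹ * ((n - 1).choose (b - 1) : ℝ) = b / n := by
  have h0 : (n.choose b : ℝ) ≠ 0 := by exact_mod_cast (Nat.choose_pos hbn).ne'
  have hn : (n : ℝ) ≠ 0 := by
    have : n ≠ 0 := by omega
    exact_mod_cast this
  obtain ⟨m, rfl⟩ : ∃ m, n = m + 1 := ⟨n - 1, by omega⟩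
  obtain ⟨c, rfl⟩ : ∃ c, b = c + 1 := ⟨b - 1, by omega⟩
  have h := Nat.add_one_mul_choose_eq m c
  have h' : ((m + 1 : ℕ) : ℝ) * (m.choose c : ℝ) = ((m + 1).choose (c + 1) : ℝ) * ((c + 1 : ℕ) : ℝ) := by
    exact_mod_cast h
  simp only [Nat.add_sub_cancel]
  rw [inv_mul_eq_div, div_eq_div_iff h0 hn]
  linarith

lemma batchMean_sum {b : ℕ} (hb : 1 ≤ b) (hbn : b ≤ n) (f : Fin n → ℝ) :
    batchMean b (fun s => ∑ i ∈ s, f i) = b / n * ∑ i, f i := by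
  have : ∑ s ∈ powersetCard b (univ : Finset (Fin n)), ∑ i ∈ s, f i
      = ∑ i, ((n - 1).choose (b - 1) : ℝ) * f i := by
    have h1 : ∀ s : Finset (Fin n), ∑ i ∈ s, f i = ∑ i, if i ∈ s then f i else 0 := by
      intro s; simp
    simp_rw [h1]
    rw [sum_comm]
    refine sum_congr rfl fun i _ => ?_
    rw [← sum_filter, sum_const, card_filter_mem_powersetCard hb, nsmul_eq_mul]
  rw [batchMean, this, ← mul_sum, ← mul_assoc, choose_pred_div_choose hb hbn]

section Variance

variable {E : Type*} [NormedAddCommGroup E] [InnerProductSpace ℝ E]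

/-- Expand the square: each index lies in d batches and each pair i ≠ j in the same number c. Since
the Y_i sum to 0, the cross terms total -c ∑ ‖Y_i‖². Only c ≥ 0 is used, so c need not be known. -/
lemma batchMean_norm_sum_sq_le {b : ℕ} (hb : 1 ≤ b) (hbn : b ≤ n) (Y : Fin n → E)
    (hY : ∑ i, Y i = 0) :
    batchMean b (fun s => ‖∑ i ∈ s, Y i‖ ^ 2) ≤ b / n * ∑ i, ‖Y i‖ ^ 2 := by
  obtain ⟨c, hc⟩ : ∃ c : ℕ, ∀ i j : Fin n, i ≠ j →
      ((powersetCard b univ).filter fun s : Finset (Fin n) => i ∈ s ∧ j ∈ s).card = c := by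
    by_cases h2 : 2 ≤ b
    · refine ⟨(n - 2).choose (b - 2), fun i j hij => ?_⟩
      have := card_filter_powersetCard_subset {i, j} (univ : Finset (Fin n)) b (subset_univ _)
        (by rw [card_pair hij]; exact h2)
      simpa [card_pair hij, insert_subset_iff] using this
    · refine ⟨0, fun i j hij => ?_⟩
      rw [card_eq_zero, filter_eq_empty_iff]
      rintro s hs ⟨hi, hj⟩
      have h1 : s.card ≤ 1 := by rw [(mem_powersetCard.1 hs).2]; omega
      exact hij (card_le_one.1 h1 i hi j hj)
  set d : ℕ := (n - 1).choose (b - 1) with hd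
  have key : ∑ s ∈ powersetCard b (univ : Finset (Fin n)), ‖∑ i ∈ s, Y i‖ ^ 2
      = (d - c : ℝ) * ∑ i, ‖Y i‖ ^ 2 := by
    have h1 : ∀ s : Finset (Fin n), ‖∑ i ∈ s, Y i‖ ^ 2
        = ∑ i, ∑ j, if i ∈ s ∧ j ∈ s then inner ℝ (Y i) (Y j) else 0 := by
      intro s
      rw [← real_inner_self_eq_norm_sq, sum_inner]
      simp_rw [inner_sum, ite_and]
      simp
    simp_rw [h1]
    rw [sum_comm]
    have h2 : ∀ i : Fin n, ∑ s ∈ powersetCard b (univ : Finset (Fin n)),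
        ∑ j, (if i ∈ s ∧ j ∈ s then inner ℝ (Y i) (Y j) else 0) = (d - c : ℝ) * ‖Y i‖ ^ 2 := by
      intro i
      rw [sum_comm]
      have h3 : ∀ j : Fin n, ∑ s ∈ powersetCard b (univ : Finset (Fin n)),
          (if i ∈ s ∧ j ∈ s then inner ℝ (Y i) (Y j) else (0 : ℝ))
          = c * inner ℝ (Y i) (Y j) + if j = i then (d - c : ℝ) * ‖Y i‖ ^ 2 else 0 := by
        intro j
        rw [← sum_filter, sum_const, nsmul_eq_mul]
        by_cases hij : j = i
        · subst hij
          simp only [and_self, if_true, card_filter_mem_powersetCard hb, real_inner_self_eq_norm_sq]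
          ring
        · rw [hc i j (Ne.symm hij)]
          simp [hij]
      simp_rw [h3]
      rw [sum_add_distrib, ← mul_sum, ← inner_sum, hY]
      simp
    simp_rw [h2, mul_sum]
  rw [batchMean, key, ← choose_pred_div_choose hb hbn, ← hd, mul_assoc]
  gcongr
  have : (0 : ℝ) ≤ c := Nat.cast_nonneg _
  linarith

/-- The deviation of a mini-batch average from the full average. -/
noncomputable def batchError (b : ℕ) (Y : Fin n → E) (s : Finset (Fin n)) : E :=
  (1 / (b : ℝ)) • ∑ i ∈ s, Y i - (1 / (n : ℝ)) • ∑ i, Y i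

lemma batchMean_inner_batchError {b : ℕ} (hb : 1 ≤ b) (hbn : b ≤ n) (Y : Fin n → E) (u : E) :
    batchMean b (fun s => inner ℝ u (batchError b Y s)) = 0 := by
  have hb0 : (b : ℝ) ≠ 0 := by exact_mod_cast (by omega : b ≠ 0)
  have h1 : (fun s : Finset (Fin n) => inner ℝ u (batchError b Y s))
      = fun s => (1 / (b : ℝ)) * ∑ i ∈ s, inner ℝ u (Y i)
        + -((1 / (n : ℝ)) * ∑ i, inner ℝ u (Y i)) := by
    funext s
    simp only [batchError, inner_sub_right, inner_smul_right, inner_sum]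
    ring
  rw [h1, batchMean_add, batchMean_const hbn, batchMean_mul_left, batchMean_sum hb hbn]
  field_simp
  ring

lemma sum_norm_sub_mean_sq_le (hn : n ≠ 0) (Y : Fin n → E) :
    ∑ i, ‖Y i - (1 / (n : ℝ)) • ∑ j, Y j‖ ^ 2 ≤ ∑ i, ‖Y i‖ ^ 2 := by
  have hn0 : (n : ℝ) ≠ 0 := by exact_mod_cast hn
  set m : E := (1 / (n : ℝ)) • ∑ j, Y j with hm
  have hs : ∑ i, Y i = (n : ℝ) • m := by rw [hm, smul_smul]; field_simp; simp
  have : ∑ i, ‖Y i - m‖ ^ 2 = ∑ i, ‖Y i‖ ^ 2 - n * ‖m‖ ^ 2 := by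
    simp_rw [norm_sub_sq_real]
    rw [sum_add_distrib, sum_sub_distrib, ← mul_sum, ← sum_inner, hs, inner_smul_left,
      real_inner_self_eq_norm_sq]
    simp
    ring
  rw [this]
  have : 0 ≤ (n : ℝ) * ‖m‖ ^ 2 := by positivity
  linarith

lemma batchMean_norm_batchError_sq_le {b : ℕ} (hb : 1 ≤ b) (hbn : b ≤ n) (Y : Fin n → E) :
    batchMean b (fun s => ‖batchError b Y s‖ ^ 2) ≤ 1 / b * (1 / n * ∑ i, ‖Y i‖ ^ 2) := by
  have hb0 : (b : ℝ) ≠ 0 := by exact_mod_cast (by omega : b ≠ 0)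
  have hn : n ≠ 0 := by omega
  have hn0 : (n : ℝ) ≠ 0 := by exact_mod_cast hn
  set m : E := (1 / (n : ℝ)) • ∑ j, Y j with hm
  have h0 : ∑ i, (Y i - m) = 0 := by
    rw [sum_sub_distrib, sum_const, card_univ, Fintype.card_fin, ← Nat.cast_smul_eq_nsmul ℝ, hm,
      smul_smul]
    field_simp
    simp
  calc batchMean b (fun s => ‖batchError b Y s‖ ^ 2)
      = batchMean b (fun s => (1 / (b : ℝ)) ^ 2 * ‖∑ i ∈ s, (Y i - m)‖ ^ 2) := by
        refine batchMean_congr fun s hs => ?_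
        have : batchError b Y s = (1 / (b : ℝ)) • ∑ i ∈ s, (Y i - m) := by
          rw [batchError, sum_sub_distrib, sum_const, hs, ← Nat.cast_smul_eq_nsmul ℝ, smul_sub,
            smul_smul, one_div_mul_cancel hb0, one_smul]
        rw [this, norm_smul, mul_pow, Real.norm_eq_abs, sq_abs]
    _ ≤ (1 / (b : ℝ)) ^ 2 * (b / n * ∑ i, ‖Y i - m‖ ^ 2) := by
        rw [batchMean_mul_left]
        gcongr
        exact batchMean_norm_sum_sq_le hb hbn _ h0
    _ ≤ (1 / (b : ℝ)) ^ 2 * (b / n * ∑ i, ‖Y i‖ ^ 2) := by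
        refine mul_le_mul_of_nonneg_left ?_ (by positivity)
        exact mul_le_mul_of_nonneg_left (sum_norm_sub_mean_sq_le hn Y) (by positivity)
    _ = _ := by field_simp

end Variance

/-! ### The deterministic energy estimates -/

section Energy

variable {E : Type*} [NormedAddCommGroup E] [InnerProductSpace ℝ E]

/-- The energy at step `k`, for `X = x^k - x⋆`, `D = x^k - x^{k-1}` and `g' = G x^{k-1}`. -/
noncomputable def energy (h : ℝ) (k : ℕ) (X D g' : E) : ℝ :=
  1 / 2 * ‖(2 : ℝ) • X + (k : ℝ) • (D + h • g')‖ ^ 2 + 2 * ‖X‖ ^ 2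
    + 1 / 4 * (k * (k + 3)) * ‖D‖ ^ 2

/-- The cross term is absorbed by ‖2D + 3q‖² ≥ 0, with the weight for which the coefficients of ‖q‖²
cancel exactly; for ‖D‖² there remains 2κ to spare. -/
lemma sq_norm_combination_lower (κ : ℝ) (hκ : 0 ≤ κ) (D q : E) :
    κ * ((κ + 1) * (κ + 4)) * ‖D‖ ^ 2 ≤
      (κ + 3) * ‖(κ + 2) • D + (3 : ℝ) • q‖ ^ 2 + 9 / 2 * κ * (κ + 3) * ‖q‖ ^ 2 := by
  have h1 : ‖(κ + 2) • D + (3 : ℝ) • q‖ ^ 2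
      = (κ + 2) ^ 2 * ‖D‖ ^ 2 + 6 * (κ + 2) * inner ℝ D q + 9 * ‖q‖ ^ 2 := by
    rw [norm_add_sq_real, norm_smul, norm_smul, inner_smul_left, inner_smul_right, mul_pow,
      mul_pow, Real.norm_eq_abs, sq_abs, Real.norm_eq_abs, sq_abs]
    simp
    ring
  have h2 : 0 ≤ ‖(2 * (κ + 2)) • D + (3 * (κ + 2)) • q‖ ^ 2 := by positivity
  have h3 : ‖(2 * (κ + 2)) • D + (3 * (κ + 2)) • q‖ ^ 2
      = (2 * (κ + 2)) ^ 2 * ‖D‖ ^ 2 + 12 * (κ + 2) ^ 2 * inner ℝ D q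
        + (3 * (κ + 2)) ^ 2 * ‖q‖ ^ 2 := by
    rw [norm_add_sq_real, norm_smul, norm_smul, inner_smul_left, inner_smul_right, mul_pow,
      mul_pow, Real.norm_eq_abs, sq_abs, Real.norm_eq_abs, sq_abs]
    simp
    ring
  rw [h3] at h2
  have hi : 0 ≤ 4 * ‖D‖ ^ 2 + 12 * inner ℝ D q + 9 * ‖q‖ ^ 2 := by
    have : 0 < (κ + 2) ^ 2 := by positivity
    refine nonneg_of_mul_nonneg_right (a := (κ + 2) ^ 2) ?_ this
    linarith
  rw [h1]
  have hD : 0 ≤ ‖D‖ ^ 2 := by positivity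
  have hq : 0 ≤ ‖q‖ ^ 2 := by positivity
  have e1 : 0 ≤ (κ + 3) * (κ + 2) * (4 * ‖D‖ ^ 2 + 12 * inner ℝ D q + 9 * ‖q‖ ^ 2) := by
    positivity
  have e2 : 0 ≤ κ * ‖D‖ ^ 2 := by positivity
  nlinarith

variable {h : ℝ} {k : ℕ} {X D D' g g' ε : E}

/-- Splitting k+5 = (k+2) + 3 leaves g on the right only through g - g', where co-coercivity between
successive iterates applies. -/
lemma step_identity
    (hrec : ((k : ℝ) + 5) • D' = (k : ℝ) • D - h • (((k : ℝ) + 3) • g - (k : ℝ) • g') - h • ε) :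
    ((k : ℝ) + 2) • D' + (3 : ℝ) • (D' + h • g) = (k : ℝ) • (D - h • (g - g')) - h • ε := by
  have : ((k : ℝ) + 2) • D' + (3 : ℝ) • (D' + h • g)
      = ((k : ℝ) + 5) • D' + (3 * h) • g := by module
  rw [this, hrec]
  module

lemma norm_smul_sub_smul_sq (a c : ℝ) (u v : E) :
    ‖a • u - c • v‖ ^ 2 = a ^ 2 * ‖u‖ ^ 2 - 2 * a * c * inner ℝ u v + c ^ 2 * ‖v‖ ^ 2 := by
  rw [norm_sub_sq_real, norm_smul, norm_smul, inner_smul_left, inner_smul_right, mul_pow,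
    mul_pow, Real.norm_eq_abs, sq_abs, Real.norm_eq_abs, sq_abs]
  simp
  ring

/-- The anchored vector z moves only by q and the noise: z' + 2q = z - hε. Squaring both sides gives
an exact identity. -/
lemma anchor_energy_step
    (hrec : ((k : ℝ) + 5) • D' = (k : ℝ) • D - h • (((k : ℝ) + 3) • g - (k : ℝ) • g') - h • ε) :
    1 / 2 * ‖(2 : ℝ) • (X + D') + ((k : ℝ) + 1) • (D' + h • g)‖ ^ 2 + 2 * ‖X + D'‖ ^ 2
      = 1 / 2 * ‖(2 : ℝ) • X + (k : ℝ) • (D + h • g')‖ ^ 2 + 2 * ‖X‖ ^ 2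
        - 4 * h * inner ℝ X g + 2 * h ^ 2 * ‖g‖ ^ 2 - 2 * (k + 3) * ‖D' + h • g‖ ^ 2
        + 1 / 2 * h ^ 2 * ‖ε‖ ^ 2
        - h * inner ℝ ((2 : ℝ) • X + (k : ℝ) • (D + h • g')) ε := by
  set z : E := (2 : ℝ) • X + (k : ℝ) • (D + h • g') with hz
  set q : E := D' + h • g with hq
  set z' : E := (2 : ℝ) • (X + D') + ((k : ℝ) + 1) • q with hz'
  have e1 : z - h • ε = z' + (2 : ℝ) • q := by
    have : h • ε = (k : ℝ) • D - h • (((k : ℝ) + 3) • g - (k : ℝ) • g') - ((k : ℝ) + 5) • D' := by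
      rw [hrec]; abel
    rw [this, hz, hz', hq]
    module
  have e2 : ‖z - h • ε‖ ^ 2 = ‖z‖ ^ 2 - 2 * h * inner ℝ z ε + h ^ 2 * ‖ε‖ ^ 2 := by
    have := norm_smul_sub_smul_sq 1 h z ε
    simpa using this
  have e3 : ‖z' + (2 : ℝ) • q‖ ^ 2 = ‖z'‖ ^ 2 + 4 * inner ℝ z' q + 4 * ‖q‖ ^ 2 := by
    rw [norm_add_sq_real, norm_smul, inner_smul_right, mul_pow, Real.norm_eq_abs, sq_abs]
    ring
  have e4 : inner ℝ z' q = 2 * inner ℝ X D' + 2 * h * inner ℝ X g + 2 * ‖D'‖ ^ 2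
      + 2 * h * inner ℝ D' g + (k + 1) * ‖q‖ ^ 2 := by
    have : inner ℝ z' q = 2 * inner ℝ (X + D') q + (k + 1) * inner ℝ q q := by
      rw [hz', inner_add_left, inner_smul_left, inner_smul_left]
      simp
    rw [this, real_inner_self_eq_norm_sq, hq, inner_add_right, inner_add_left, inner_add_left,
      inner_smul_right, inner_smul_right, real_inner_self_eq_norm_sq]
    ring
  have e5 : ‖X + D'‖ ^ 2 = ‖X‖ ^ 2 + 2 * inner ℝ X D' + ‖D'‖ ^ 2 := norm_add_sq_real _ _
  have e6 : ‖q‖ ^ 2 = ‖D'‖ ^ 2 + 2 * h * inner ℝ D' g + h ^ 2 * ‖g‖ ^ 2 := by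
    rw [hq, norm_add_sq_real, inner_smul_right, norm_smul, mul_pow, Real.norm_eq_abs, sq_abs]
    ring
  rw [e1, e3, e4] at e2
  rw [e5]
  linear_combination (1 / 2 : ℝ) * e2 + 2 * e6

lemma energy_step (hk : k = 0 → ε = 0)
    (hrec : ((k : ℝ) + 5) • D' = (k : ℝ) • D - h • (((k : ℝ) + 3) • g - (k : ℝ) • g') - h • ε) :
    energy h (k + 1) (X + D') D' g ≤ energy h k X D g'
      - 4 * h * inner ℝ X g + 2 * h ^ 2 * ‖g‖ ^ 2 - 7 / 8 * (k + 3) * ‖D' + h • g‖ ^ 2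
      - 1 / 4 * (k * (k + 3)) * (2 * h * inner ℝ D (g - g') - h ^ 2 * ‖g - g'‖ ^ 2)
      + 3 / 2 * h ^ 2 * ‖ε‖ ^ 2
      - h * inner ℝ ((2 : ℝ) • X + (k : ℝ) • (D + h • g')
          + (1 / 2 * ((k : ℝ) + 3)) • (D - h • (g - g'))) ε := by
  have h1 := anchor_energy_step (X := X) hrec
  -- A quarter of this is added to the anchor identity: 2 - 9/8 = 7/8 for ‖q‖² and 1/2 + 1 = 3/2 for
  -- h²‖ε‖².
  have key : ((k : ℝ) + 1) * (k + 4) * ‖D'‖ ^ 2 ≤ k * (k + 3) * ‖D - h • (g - g')‖ ^ 2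
      - 2 * (k + 3) * h * inner ℝ (D - h • (g - g')) ε + 4 * h ^ 2 * ‖ε‖ ^ 2
      + 9 / 2 * (k + 3) * ‖D' + h • g‖ ^ 2 := by
    have h2 := sq_norm_combination_lower (k : ℝ) (Nat.cast_nonneg k) D' (D' + h • g)
    have hid := step_identity hrec
    -- The weighted inequality carries a factor k that must be cancelled. At k = 0 the noise
    -- vanishes and 2D' = -3q gives the bound directly.
    rcases Nat.eq_zero_or_pos k with h0 | hpos
    · have hε := hk h0
      subst h0
      have hid' : (2 : ℝ) • D' = -((3 : ℝ) • (D' + h • g)) := by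
        rw [eq_neg_iff_add_eq_zero]
        simpa [hε] using hid
      have := congrArg (fun v => ‖v‖ ^ 2) hid'
      simp only [norm_neg, norm_smul, mul_pow, Real.norm_eq_abs, sq_abs] at this
      simp [hε]
      nlinarith [sq_nonneg ‖D' + h • g‖]
    · rw [hid, norm_smul_sub_smul_sq] at h2
      have hk1 : (1 : ℝ) ≤ k := by exact_mod_cast hpos
      have hk0 : (0 : ℝ) < k := by linarith
      refine le_of_mul_le_mul_left ?_ hk0
      -- This is (k+3)/k ≤ 4 for k ≥ 1, the origin of the factor 4.
      have : ((k : ℝ) + 3) * (h ^ 2 * ‖ε‖ ^ 2) ≤ k * (4 * h ^ 2 * ‖ε‖ ^ 2) := by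
        have : 0 ≤ h ^ 2 * ‖ε‖ ^ 2 := by positivity
        nlinarith
      linarith
  have e : ‖D - h • (g - g')‖ ^ 2
      = ‖D‖ ^ 2 - 2 * h * inner ℝ D (g - g') + h ^ 2 * ‖g - g'‖ ^ 2 := by
    simpa using norm_smul_sub_smul_sq 1 h D (g - g')
  rw [e] at key
  unfold energy
  rw [inner_add_left, inner_smul_left]
  simp only [conj_trivial]
  push_cast
  have hc : ((k : ℝ) + 1) * (k + 1 + 3) = (k + 1) * (k + 4) := by ring
  rw [hc]
  linarith

/-- With ‖D' + 3q‖² ≥ 0 for the cross term, (k+2)² - (k+2) = (k+1)² + (k+1). The surplus (k+1)‖D'‖²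
is what makes k E‖D‖² summable. -/
lemma increment_step
    (hrec : ((k : ℝ) + 5) • D' = (k : ℝ) • D - h • (((k : ℝ) + 3) • g - (k : ℝ) • g') - h • ε) :
    ((k : ℝ) + 1) ^ 2 * ‖D'‖ ^ 2 + (k + 1) * ‖D'‖ ^ 2 ≤
      (k : ℝ) ^ 2 * (‖D‖ ^ 2 - (2 * h * inner ℝ D (g - g') - h ^ 2 * ‖g - g'‖ ^ 2))
        - 2 * k * h * inner ℝ (D - h • (g - g')) ε + h ^ 2 * ‖ε‖ ^ 2
        + 9 * (k + 2) * ‖D' + h • g‖ ^ 2 := by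
  have hid := congrArg (fun v => ‖v‖ ^ 2) (step_identity hrec)
  simp only [norm_smul_sub_smul_sq] at hid
  set q : E := D' + h • g
  have e : ‖D - h • (g - g')‖ ^ 2
      = ‖D‖ ^ 2 - 2 * h * inner ℝ D (g - g') + h ^ 2 * ‖g - g'‖ ^ 2 := by
    simpa using norm_smul_sub_smul_sq 1 h D (g - g')
  have h1 : ‖((k : ℝ) + 2) • D' + (3 : ℝ) • q‖ ^ 2
      = ((k : ℝ) + 2) ^ 2 * ‖D'‖ ^ 2 + 6 * (k + 2) * inner ℝ D' q + 9 * ‖q‖ ^ 2 := by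
    have := norm_smul_sub_smul_sq ((k : ℝ) + 2) (-3) D' q
    simp only [neg_smul, sub_neg_eq_add] at this
    rw [this]; ring
  have h2 : 0 ≤ ‖D'‖ ^ 2 + 6 * inner ℝ D' q + 9 * ‖q‖ ^ 2 := by
    have := norm_smul_sub_smul_sq 1 (-3) D' q
    have h0 : 0 ≤ ‖(1 : ℝ) • D' - (-3 : ℝ) • q‖ ^ 2 := by positivity
    linarith
  have hk : (0 : ℝ) ≤ k := Nat.cast_nonneg k
  have h3 : 0 ≤ ((k : ℝ) + 2) * (‖D'‖ ^ 2 + 6 * inner ℝ D' q + 9 * ‖q‖ ^ 2) := by positivity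
  rw [h1, e] at hid
  have h4 : 0 ≤ ‖q‖ ^ 2 := by positivity
  linarith

/-- The split k+5 = (k+3) + 2 and ‖q + 2D'‖² ≥ 0. This controls the increases of k²‖q‖² once k‖D‖²
is known to be summable. -/
lemma residual_step
    (hrec : ((k : ℝ) + 5) • D' = (k : ℝ) • D - h • (((k : ℝ) + 3) • g - (k : ℝ) • g') - h • ε) :
    ((k : ℝ) + 1) ^ 2 * ‖D' + h • g‖ ^ 2 ≤
      (k : ℝ) ^ 2 * ‖D + h • g'‖ ^ 2 - 2 * k * h * inner ℝ (D + h • g') ε + h ^ 2 * ‖ε‖ ^ 2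
        + 4 * (k + 3) * ‖D'‖ ^ 2 := by
  set q : E := D' + h • g with hq
  have hid : ((k : ℝ) + 3) • q + (2 : ℝ) • D' = (k : ℝ) • (D + h • g') - h • ε := by
    have : ((k : ℝ) + 3) • q + (2 : ℝ) • D' = ((k : ℝ) + 5) • D' + (((k : ℝ) + 3) * h) • g := by
      rw [hq]; module
    rw [this, hrec]
    module
  have h1 : ‖((k : ℝ) + 3) • q + (2 : ℝ) • D'‖ ^ 2
      = ((k : ℝ) + 3) ^ 2 * ‖q‖ ^ 2 + 4 * (k + 3) * inner ℝ q D' + 4 * ‖D'‖ ^ 2 := by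
    have := norm_smul_sub_smul_sq ((k : ℝ) + 3) (-2) q D'
    simp only [neg_smul, sub_neg_eq_add] at this
    rw [this]; ring
  rw [hid, norm_smul_sub_smul_sq] at h1
  have h2 : 0 ≤ ‖q‖ ^ 2 + 4 * inner ℝ q D' + 4 * ‖D'‖ ^ 2 := by
    have := norm_smul_sub_smul_sq 1 (-2) q D'
    have h0 : 0 ≤ ‖(1 : ℝ) • q - (-2 : ℝ) • D'‖ ^ 2 := by positivity
    linarith
  have hk : (0 : ℝ) ≤ k := Nat.cast_nonneg k
  have h3 : 0 ≤ ((k : ℝ) + 3) * (‖q‖ ^ 2 + 4 * inner ℝ q D' + 4 * ‖D'‖ ^ 2) := by positivity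
  have h4 : 0 ≤ (k : ℝ) * ‖q‖ ^ 2 := by positivity
  have h5 : 0 ≤ ‖q‖ ^ 2 := by positivity
  have h6 : 0 ≤ ‖D'‖ ^ 2 := by positivity
  nlinarith

lemma increment_le_energy : (k : ℝ) * (k + 3) * ‖D‖ ^ 2 ≤ 4 * energy h k X D g' := by
  unfold energy
  have h1 : 0 ≤ ‖(2 : ℝ) • X + (k : ℝ) • (D + h • g')‖ ^ 2 := by positivity
  have h2 : 0 ≤ ‖X‖ ^ 2 := by positivity
  linarith

/-- Here k h g' = z - 2X - kD, and (a+b+c)² ≤ 3(a²+b²+c²) matches the three terms of the energy. -/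
lemma operator_le_energy : (k : ℝ) ^ 2 * h ^ 2 * ‖g'‖ ^ 2 ≤ 12 * energy h k X D g' := by
  set z : E := (2 : ℝ) • X + (k : ℝ) • (D + h • g') with hz
  have e : ((k : ℝ) * h) • g' = z - (2 : ℝ) • X - (k : ℝ) • D := by rw [hz]; module
  have h1 : (k : ℝ) ^ 2 * h ^ 2 * ‖g'‖ ^ 2 = ‖z - (2 : ℝ) • X - (k : ℝ) • D‖ ^ 2 := by
    rw [← e, norm_smul, mul_pow, Real.norm_eq_abs, sq_abs]; ring
  have h2 : ‖z - (2 : ℝ) • X - (k : ℝ) • D‖ ≤ ‖z‖ + 2 * ‖X‖ + k * ‖D‖ := by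
    refine (norm_sub_le _ _).trans ?_
    have := norm_sub_le z ((2 : ℝ) • X)
    simp only [norm_smul, Real.norm_eq_abs, Nat.abs_cast, abs_two] at this ⊢
    linarith
  have h3 : ‖z - (2 : ℝ) • X - (k : ℝ) • D‖ ^ 2 ≤ (‖z‖ + 2 * ‖X‖ + k * ‖D‖) ^ 2 := by gcongr
  have hk : 0 ≤ (k : ℝ) * ‖D‖ ^ 2 := by positivity
  unfold energy
  rw [← hz, h1]
  nlinarith [sq_nonneg (‖z‖ - 2 * ‖X‖), sq_nonneg (‖z‖ - k * ‖D‖),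
    sq_nonneg (2 * ‖X‖ - k * ‖D‖)]

end Energy

/-! ### Expectations over the batches -/

section Probability

variable {Ω : Type*} [MeasurableSpace Ω] {μ : Measure Ω} [IsProbabilityMeasure μ]

section FiniteHistory

variable {α : Type*} [Finite α] [MeasurableSpace α] [MeasurableSingletonClass α] {H : Ω → α}

/-- A function of finitely many outcomes is bounded and measurable, so nothing need be assumed about
`f` or, later, about the G_i. -/
lemma integrable_of_factorsThrough {f : Ω → ℝ} (hH : Measurable H)
    (hf : f.FactorsThrough H) : Integrable f μ := by
  rw [← hf.extend_comp (fun _ => 0)]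
  have : IsProbabilityMeasure (μ.map H) := Measure.isProbabilityMeasure_map hH.aemeasurable
  exact Integrable.comp_measurable (Integrable.of_finite) hH

variable {Z : Ω → Finset (Fin n)} {b : ℕ}

/-- The prescribed masses of the b-element subsets already add up to 1, so all other values are
null. -/
lemma ae_card_eq_of_uniform (hbn : b ≤ n) (hZ : Measurable Z)
    (hu : ∀ s : Finset (Fin n), s.card = b → μ.real {ω | Z ω = s} = 1 / (n.choose b : ℝ)) :
    ∀ᵐ ω ∂μ, (Z ω).card = b := by
  have hc : (n.choose b : ℝ) ≠ 0 := by exact_mod_cast (Nat.choose_pos hbn).ne'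
  have h1 : μ.real (Z ⁻¹' ↑(powersetCard b (univ : Finset (Fin n)))) = 1 := by
    rw [← sum_measureReal_preimage_singleton _ fun s _ => hZ (measurableSet_singleton s)]
    have : ∀ s ∈ powersetCard b (univ : Finset (Fin n)), μ.real (Z ⁻¹' {s})
        = 1 / (n.choose b : ℝ) := fun s hs => hu s (mem_powersetCard.1 hs).2
    rw [sum_congr rfl this, sum_const, card_powersetCard, card_univ, Fintype.card_fin,
      nsmul_eq_mul]
    field_simp
  have h2 : μ (Z ⁻¹' ↑(powersetCard b (univ : Finset (Fin n)))) = 1 := by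
    rw [measureReal_def, ENNReal.toReal_eq_one_iff] at h1
    exact h1
  have h3 := (mem_ae_iff_prob_eq_one (hZ (Set.toFinite _).measurableSet)).2 h2
  filter_upwards [h3] with ω hω
  exact (mem_powersetCard.1 (mem_coe.1 (Set.mem_preimage.1 hω))).2

/-- Averaging out a uniform batch that is independent of the history. -/
lemma integral_comp_uniform (hbn : b ≤ n) (hH : Measurable H) (hZ : Measurable Z)
    (hu : ∀ s : Finset (Fin n), s.card = b → μ.real {ω | Z ω = s} = 1 / (n.choose b : ℝ))
    (hind : IndepFun H Z μ) {F : Finset (Fin n) → Ω → ℝ} (hF : ∀ s, (F s).FactorsThrough H) :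
    ∫ ω, F (Z ω) ω ∂μ = ∫ ω, batchMean b (fun s => F s ω) ∂μ := by
  have hint : ∀ s, Integrable (F s) μ := fun s => integrable_of_factorsThrough hH (hF s)
  have hmeas : ∀ s, MeasurableSet {ω | Z ω = s} := fun s => hZ (measurableSet_singleton s)
  have hprod : ∀ s, ∫ ω, {ω | Z ω = s}.indicator (F s) ω ∂μ
      = (∫ ω, F s ω ∂μ) * μ.real {ω | Z ω = s} := by
    intro s
    have hi : IndepFun (F s) ({ω | Z ω = s}.indicator fun _ => (1 : ℝ)) μ := by
      have e1 : Function.extend H (F s) (fun _ => 0) ∘ H = F s := (hF s).extend_comp _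
      have e2 : (({s} : Set (Finset (Fin n))).indicator fun _ => (1 : ℝ)) ∘ Z
          = {ω | Z ω = s}.indicator fun _ => (1 : ℝ) := by
        funext ω
        by_cases h : Z ω = s <;> simp [Set.indicator, h]
      rw [← e1, ← e2]
      exact hind.comp Measurable.of_discrete Measurable.of_discrete
    have h1 := hi.integral_mul_eq_mul_integral (hint s).aestronglyMeasurable
      (aestronglyMeasurable_const.indicator (hmeas s))
    rw [integral_indicator_const _ (hmeas s)] at h1
    simp only [smul_eq_mul, mul_one] at h1
    rw [← h1]
    refine integral_congr_ae (Filter.Eventually.of_forall fun ω => ?_)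
    by_cases h : Z ω = s <;> simp [Set.indicator, h]
  have hsum : ∀ᵐ ω ∂μ, F (Z ω) ω
      = ∑ s ∈ powersetCard b (univ : Finset (Fin n)), {ω | Z ω = s}.indicator (F s) ω := by
    filter_upwards [ae_card_eq_of_uniform hbn hZ hu] with ω hω
    rw [sum_eq_single (Z ω)]
    · simp
    · intro s _ hs
      simp [Set.indicator, Ne.symm hs]
    · intro h
      exact absurd (mem_powersetCard.2 ⟨subset_univ _, hω⟩) h
  rw [integral_congr_ae hsum, integral_finsetSum _ fun s _ => (hint s).indicator (hmeas s)]
  simp only [batchMean]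
  rw [integral_const_mul, integral_finsetSum _ fun s _ => hint s, mul_sum]
  refine sum_congr rfl fun s hs => ?_
  rw [hprod, hu s (mem_powersetCard.1 hs).2]
  ring

end FiniteHistory

variable {A B : ℕ → Ω → Finset (Fin n)}

/-- The batches drawn before iteration `k`. -/
def history (A B : ℕ → Ω → Finset (Fin n)) (k : ℕ) (ω : Ω) :
    range k → Finset (Fin n) × Finset (Fin n) :=
  fun j => (A j ω, B j ω)

omit [MeasurableSpace Ω] in
lemma history_succ_factorsThrough (k : ℕ) :
    (fun ω => (history A B k ω, A k ω, B k ω)).FactorsThrough (history A B (k + 1)) := by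
  intro ω ω' h
  have h' : ∀ j, j < k + 1 → A j ω = A j ω' ∧ B j ω = B j ω' := fun j hj => by
    have := congrFun h ⟨j, mem_range.2 hj⟩
    simpa [history] using this
  simp only [Prod.mk.injEq]
  refine ⟨?_, h' k (by omega)⟩
  funext j
  have := h' j (by have := mem_range.1 j.2; omega)
  simp [history, this]

variable {b : ℕ}

omit [IsProbabilityMeasure μ] in
lemma Sampling.measurable_history (hS : Sampling μ b A B) (k : ℕ) :
    Measurable (history A B k) :=
  measurable_pi_lambda _ fun j => (hS.measurable_A j).prodMk (hS.measurable_B j)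

omit [IsProbabilityMeasure μ] in
lemma Sampling.indepFun_history (hS : Sampling μ b A B) (k : ℕ) :
    IndepFun (history A B k) (fun ω => (A k ω, B k ω)) μ := by
  have h := hS.indep.indepFun_finset (range k) {k} (by simp)
    fun j => (hS.measurable_A j).prodMk (hS.measurable_B j)
  exact h.comp (φ := id) (ψ := fun v => v ⟨k, mem_singleton_self k⟩) measurable_id
    Measurable.of_discrete

lemma Sampling.integral_comp_A (hS : Sampling μ b A B) (hbn : b ≤ n) (k : ℕ)
    {F : Finset (Fin n) → Ω → ℝ} (hF : ∀ s, (F s).FactorsThrough (history A B k)) :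
    ∫ ω, F (A k ω) ω ∂μ = ∫ ω, batchMean b (fun s => F s ω) ∂μ :=
  integral_comp_uniform hbn (hS.measurable_history k) (hS.measurable_A k) (hS.uniform_A k)
    ((hS.indepFun_history k).comp measurable_id measurable_fst) hF

lemma Sampling.integral_comp_B (hS : Sampling μ b A B) (hbn : b ≤ n) (k : ℕ)
    {F : Finset (Fin n) → Ω → ℝ} (hF : ∀ s, (F s).FactorsThrough (history A B k)) :
    ∫ ω, F (B k ω) ω ∂μ = ∫ ω, batchMean b (fun s => F s ω) ∂μ :=
  integral_comp_uniform hbn (hS.measurable_history k) (hS.measurable_B k) (hS.uniform_B k)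
    ((hS.indepFun_history k).comp measurable_id measurable_snd) hF

end Probability

/-! ### The method along one realization -/

section Deterministic

variable (G : Fin n → EuclideanSpace ℝ (Fin p) → EuclideanSpace ℝ (Fin p))

/-- The mean squared distance of the component values at two points. -/
noncomputable def compDist (x y : EuclideanSpace ℝ (Fin p)) : ℝ :=
  1 / (n : ℝ) * ∑ i, ‖G i x - G i y‖ ^ 2

/-- The mean squared error of the table. -/
noncomputable def tableError (σ : State n p) : ℝ :=
  1 / (n : ℝ) * ∑ i, ‖G i σ.cur - σ.table i‖ ^ 2

/-- The error of the estimator in iteration `k`, scaled by `k + 3`. -/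
noncomputable def noise (k : ℕ) (s : Finset (Fin n)) (σ : State n p) :
    EuclideanSpace ℝ (Fin p) :=
  if k = 0 then 0 else
    ((k : ℝ) + 3) • (sagaEstimator G ((k : ℝ) / (k + 3)) s σ.table σ.prev σ.cur
      - (avg G σ.cur - ((k : ℝ) / (k + 3)) • avg G σ.prev))

variable {G}

lemma compDist_nonneg (x y : EuclideanSpace ℝ (Fin p)) : 0 ≤ compDist G x y := by
  unfold compDist; positivity

lemma tableError_nonneg (σ : State n p) : 0 ≤ tableError G σ := by
  unfold tableError; positivity

lemma avg_sub_avg (x y : EuclideanSpace ℝ (Fin p)) :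
    avg G x - avg G y = (1 / (n : ℝ)) • ∑ i, (G i x - G i y) := by
  simp [avg, smul_sub]

lemma norm_avg_sub_sq_le (hn : n ≠ 0) (x y : EuclideanSpace ℝ (Fin p)) :
    ‖avg G x - avg G y‖ ^ 2 ≤ compDist G x y := by
  have hn0 : (0 : ℝ) < n := by exact_mod_cast Nat.pos_of_ne_zero hn
  rw [avg_sub_avg, norm_smul, mul_pow, Real.norm_eq_abs, sq_abs]
  have h1 : ‖∑ i, (G i x - G i y)‖ ^ 2 ≤ n * ∑ i, ‖G i x - G i y‖ ^ 2 := by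
    calc ‖∑ i, (G i x - G i y)‖ ^ 2 ≤ (∑ i, ‖G i x - G i y‖) ^ 2 := by
          gcongr; exact norm_sum_le _ _
      _ ≤ _ := by simpa using sq_sum_le_card_mul_sum_sq (s := univ) (f := fun i => ‖G i x - G i y‖)
  unfold compDist
  calc (1 / (n : ℝ)) ^ 2 * ‖∑ i, (G i x - G i y)‖ ^ 2
      ≤ (1 / (n : ℝ)) ^ 2 * (n * ∑ i, ‖G i x - G i y‖ ^ 2) := by gcongr
    _ = _ := by field_simp

lemma AvgCocoercive.compDist_le {L : ℝ} (hG : AvgCocoercive G L)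
    (x y : EuclideanSpace ℝ (Fin p)) :
    1 / L * compDist G x y ≤ inner ℝ (x - y) (avg G x - avg G y) := by
  have := hG x y
  rw [avg_sub_avg, inner_smul_right, inner_sum]
  simp_rw [real_inner_comm (_ : EuclideanSpace ℝ (Fin p)) (x - y)]
  exact this

variable {β : ℝ} {x0 : EuclideanSpace ℝ (Fin p)} {A B : ℕ → Finset (Fin n)}

lemma state_congr {A' B' : ℕ → Finset (Fin n)} (r : ℝ) (k : ℕ)
    (h : ∀ j < k, A j = A' j ∧ B j = B' j) :
    state G r β x0 A B k = state G r β x0 A' B' k := by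
  induction k with
  | zero => rfl
  | succ k ih =>
    have h1 := ih fun j hj => h j (by omega)
    have h2 := h k (by omega)
    simp only [state, h1, h2.1, h2.2]

lemma state_succ_rec (k : ℕ) :
    ((k : ℝ) + 5) • ((state G 3 β x0 A B (k + 1)).cur - (state G 3 β x0 A B k).cur)
      = (k : ℝ) • ((state G 3 β x0 A B k).cur - (state G 3 β x0 A B k).prev)
        - (2 * β) • (((k : ℝ) + 3) • avg G (state G 3 β x0 A B k).cur
            - (k : ℝ) • avg G (state G 3 β x0 A B k).prev)
        - (2 * β) • noise G k (B k) (state G 3 β x0 A B k) := by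
  have h3 : (k : ℝ) + 3 ≠ 0 := by positivity
  have h5 : (k : ℝ) + 5 ≠ 0 := by positivity
  have h5' : (k : ℝ) + 3 + 2 = k + 5 := by ring
  simp only [state, h5']
  set σ := state G 3 β x0 A B k
  set g := avg G σ.cur
  set g' := avg G σ.prev
  have key : ∀ S : EuclideanSpace ℝ (Fin p),
      ((k : ℝ) + 5) • (σ.cur + ((k : ℝ) / (k + 5)) • (σ.cur - σ.prev)
        - (2 * β * (k + 3) / (k + 5)) • S - σ.cur)
      = (k : ℝ) • (σ.cur - σ.prev) - (2 * β) • (((k : ℝ) + 3) • S) := by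
    intro S
    have e : σ.cur + ((k : ℝ) / (k + 5)) • (σ.cur - σ.prev)
        - (2 * β * (k + 3) / (k + 5)) • S - σ.cur
        = ((k : ℝ) / (k + 5)) • (σ.cur - σ.prev) - (2 * β * (k + 3) / (k + 5)) • S := by abel
    rw [e, smul_sub, smul_smul, smul_smul, smul_smul, mul_div_cancel₀ _ h5, mul_div_cancel₀ _ h5]
  rw [key, sub_sub, ← smul_add]
  congr 2
  have e2 : ((k : ℝ) + 3) • (g - ((k : ℝ) / (k + 3)) • g') = ((k : ℝ) + 3) • g - (k : ℝ) • g' := by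
    rw [smul_sub, smul_smul, mul_div_cancel₀ _ h3]
  unfold noise
  split_ifs with hk
  · rw [e2, add_zero]
  · rw [smul_sub _ (sagaEstimator _ _ _ _ _ _), e2]
    abel

/-- For γ = k/(k+3), (k+3)γ = k and (k+3)(1-γ) = 3: the table error keeps a bounded weight while the
difference of iterates is weighted by k. -/
lemma noise_eq_batchError {k b : ℕ} (hk : k ≠ 0) (s : Finset (Fin n)) (hs : s.card = b)
    (σ : State n p) :
    noise G k s σ = batchError b
      (fun i => (k : ℝ) • (G i σ.cur - G i σ.prev) + (3 : ℝ) • (G i σ.cur - σ.table i)) s := by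
  have h3 : (k : ℝ) + 3 ≠ 0 := by positivity
  have hγ : ((k : ℝ) + 3) * ((k : ℝ) / (k + 3)) = k := mul_div_cancel₀ _ h3
  have hγ' : ((k : ℝ) + 3) * (1 - (k : ℝ) / (k + 3)) = 3 := by rw [mul_sub, hγ]; ring
  simp only [noise, hk, if_false, sagaEstimator, avg, batchError, hs, sum_add_distrib, ← smul_sum,
    sum_sub_distrib, smul_sub, smul_add, smul_smul]
  set γ := (k : ℝ) / (k + 3)
  have e1 : ((k : ℝ) + 3) * ((1 - γ) / n) = 3 * (1 / n) := by
    rw [← mul_div_assoc, hγ']; ring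
  have e2 : ∀ c : ℝ, ((k : ℝ) + 3) * (γ * c) = k * c := fun c => by rw [← mul_assoc, hγ]
  have e3 : ∀ c : ℝ, ((k : ℝ) + 3) * ((1 - γ) * c) = 3 * c := fun c => by rw [← mul_assoc, hγ']
  simp only [e1, e2, e3]
  module

lemma batchMean_inner_noise {k b : ℕ} (hb : 1 ≤ b) (hbn : b ≤ n) (σ : State n p)
    (u : EuclideanSpace ℝ (Fin p)) :
    batchMean b (fun s => inner ℝ u (noise G k s σ)) = 0 := by
  by_cases hk : k = 0
  · simp [noise, hk, batchMean_const hbn]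
  · rw [batchMean_congr fun s hs => by rw [noise_eq_batchError hk s hs]]
    exact batchMean_inner_batchError hb hbn _ u

lemma batchMean_norm_noise_sq_le {k b : ℕ} (hb : 1 ≤ b) (hbn : b ≤ n) (σ : State n p) :
    batchMean b (fun s => ‖noise G k s σ‖ ^ 2)
      ≤ 1 / b * (2 * k ^ 2 * compDist G σ.cur σ.prev + 18 * tableError G σ) := by
  have hc := compDist_nonneg (G := G) σ.cur σ.prev
  have ht := tableError_nonneg (G := G) σ
  by_cases hk : k = 0
  · simp only [noise, hk, if_true, norm_zero]
    rw [batchMean_const hbn, zero_pow two_ne_zero]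
    positivity
  · rw [batchMean_congr fun s hs => by rw [noise_eq_batchError hk s hs]]
    refine (batchMean_norm_batchError_sq_le hb hbn _).trans ?_
    gcongr
    have h1 : ∀ i, ‖(k : ℝ) • (G i σ.cur - G i σ.prev) + (3 : ℝ) • (G i σ.cur - σ.table i)‖ ^ 2
        ≤ 2 * k ^ 2 * ‖G i σ.cur - G i σ.prev‖ ^ 2 + 18 * ‖G i σ.cur - σ.table i‖ ^ 2 := by
      intro i
      set v := (k : ℝ) • (G i σ.cur - G i σ.prev) with hv
      set w := (3 : ℝ) • (G i σ.cur - σ.table i) with hw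
      have h2 := parallelogram_law_with_norm ℝ v w
      have ev : ‖v‖ * ‖v‖ = k ^ 2 * ‖G i σ.cur - G i σ.prev‖ ^ 2 := by
        rw [hv, norm_smul, Real.norm_eq_abs, Nat.abs_cast]; ring
      have ew : ‖w‖ * ‖w‖ = 9 * ‖G i σ.cur - σ.table i‖ ^ 2 := by
        rw [hw, norm_smul, Real.norm_ofNat]; ring
      nlinarith [mul_self_nonneg ‖v - w‖]
    calc 1 / (n : ℝ) * ∑ i, ‖(k : ℝ) • (G i σ.cur - G i σ.prev)
            + (3 : ℝ) • (G i σ.cur - σ.table i)‖ ^ 2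
        ≤ 1 / (n : ℝ) * ∑ i, (2 * k ^ 2 * ‖G i σ.cur - G i σ.prev‖ ^ 2
            + 18 * ‖G i σ.cur - σ.table i‖ ^ 2) := by
          gcongr with i
          exact h1 i
      _ = _ := by
          rw [sum_add_distrib, ← mul_sum, ← mul_sum, compDist, tableError]
          ring

/-- Young's inequality separates the refresh, driven by A_k, from the displacement to x^{k+1},
driven by B_k. No joint law of the two batches is needed afterwards. -/
lemma tableError_state_succ_le {c : ℝ} (hc : 0 < c) (k : ℕ) :
    tableError G (state G 3 β x0 A B (k + 1)) ≤
      (1 + c) * (1 / n * ∑ i, if i ∈ A k then 0 else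
        ‖G i (state G 3 β x0 A B k).cur - (state G 3 β x0 A B k).table i‖ ^ 2)
      + (1 + 1 / c) * compDist G (state G 3 β x0 A B (k + 1)).cur
          (state G 3 β x0 A B (k + 1)).prev := by
  have hp : (state G 3 β x0 A B (k + 1)).prev = (state G 3 β x0 A B k).cur := rfl
  have ht : (state G 3 β x0 A B (k + 1)).table = fun i =>
      if i ∈ A k then G i (state G 3 β x0 A B k).cur else (state G 3 β x0 A B k).table i := rfl
  rw [tableError, compDist, hp, ht]
  set y := (state G 3 β x0 A B (k + 1)).cur
  set σ := state G 3 β x0 A B k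
  have h1 : ∀ u v : EuclideanSpace ℝ (Fin p),
      ‖u + v‖ ^ 2 ≤ (1 + c) * ‖v‖ ^ 2 + (1 + 1 / c) * ‖u‖ ^ 2 := by
    intro u v
    have h2 : ‖u + v‖ ^ 2 ≤ (‖u‖ + ‖v‖) ^ 2 := by gcongr; exact norm_add_le _ _
    have h3 : 0 ≤ 1 / c * (‖u‖ - c * ‖v‖) ^ 2 := by positivity
    have h4 : 1 / c * (‖u‖ - c * ‖v‖) ^ 2
        = 1 / c * ‖u‖ ^ 2 - 2 * ‖u‖ * ‖v‖ + c * ‖v‖ ^ 2 := by field_simp; ring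
    nlinarith
  calc 1 / (n : ℝ) * ∑ i, ‖G i y - (if i ∈ A k then G i σ.cur else σ.table i)‖ ^ 2
      ≤ 1 / (n : ℝ) * ∑ i, ((1 + c) * (if i ∈ A k then 0 else ‖G i σ.cur - σ.table i‖ ^ 2)
          + (1 + 1 / c) * ‖G i y - G i σ.cur‖ ^ 2) := by
        gcongr with i
        by_cases hi : i ∈ A k
        · have : 0 ≤ 1 / c * ‖G i y - G i σ.cur‖ ^ 2 := by positivity
          simp only [hi, if_true]
          linarith
        · simp only [hi, if_false]
          simpa using h1 (G i y - G i σ.cur) (G i σ.cur - σ.table i)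
    _ = _ := by
        rw [sum_add_distrib, ← mul_sum, ← mul_sum]
        ring

lemma batchMean_tableError {b : ℕ} (hb : 1 ≤ b) (hbn : b ≤ n) (σ : State n p) :
    batchMean b (fun s => 1 / (n : ℝ) * ∑ i, if i ∈ s then 0 else ‖G i σ.cur - σ.table i‖ ^ 2)
      = (1 - b / n) * tableError G σ := by
  have h : (fun s : Finset (Fin n) =>
      1 / (n : ℝ) * ∑ i, if i ∈ s then 0 else ‖G i σ.cur - σ.table i‖ ^ 2)
      = fun s => 1 / (n : ℝ) * (∑ i, ‖G i σ.cur - σ.table i‖ ^ 2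
        + -1 * ∑ i ∈ s, ‖G i σ.cur - σ.table i‖ ^ 2) := by
    funext s
    congr 1
    rw [neg_one_mul, ← sub_eq_add_neg, eq_sub_iff_add_eq]
    have : ∑ i ∈ s, ‖G i σ.cur - σ.table i‖ ^ 2
        = ∑ i, if i ∈ s then ‖G i σ.cur - σ.table i‖ ^ 2 else 0 := by simp
    rw [this, ← sum_add_distrib]
    refine sum_congr rfl fun i _ => ?_
    by_cases hi : i ∈ s <;> simp [hi]
  rw [h, batchMean_mul_left, batchMean_add, batchMean_const hbn, batchMean_mul_left,
    batchMean_sum hb hbn, tableError]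
  ring

end Deterministic

/-! ### Expected one-step estimates -/

section RandomState

variable {Ω : Type*}

/-- The state of the method as a random variable. -/
noncomputable def process (G : Fin n → EuclideanSpace ℝ (Fin p) → EuclideanSpace ℝ (Fin p))
    (β : ℝ) (x0 : EuclideanSpace ℝ (Fin p)) (A B : ℕ → Ω → Finset (Fin n)) (k : ℕ) (ω : Ω) :
    State n p :=
  state G 3 β x0 (fun j => A j ω) (fun j => B j ω) k

variable {G : Fin n → EuclideanSpace ℝ (Fin p) → EuclideanSpace ℝ (Fin p)}
  {β : ℝ} {x0 : EuclideanSpace ℝ (Fin p)} {A B : ℕ → Ω → Finset (Fin n)}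

lemma process_factorsThrough (k : ℕ) :
    (process G β x0 A B k).FactorsThrough (history A B k) := by
  intro ω ω' h
  refine state_congr 3 k fun j hj => ?_
  have := congrFun h ⟨j, mem_range.2 hj⟩
  simpa [history] using this

variable [MeasurableSpace Ω] {μ : Measure Ω} [IsProbabilityMeasure μ] {b : ℕ}

lemma integrable_process (hS : Sampling μ b A B) (k : ℕ) (φ : State n p → ℝ) :
    Integrable (fun ω => φ (process G β x0 A B k ω)) μ :=
  integrable_of_factorsThrough (hS.measurable_history k) ((process_factorsThrough k).comp_left φ)

lemma integrable_process_batches (hS : Sampling μ b A B) (k : ℕ)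
    (φ : Finset (Fin n) → Finset (Fin n) → State n p → ℝ) :
    Integrable (fun ω => φ (A k ω) (B k ω) (process G β x0 A B k ω)) μ := by
  refine integrable_of_factorsThrough (hS.measurable_history (k + 1)) fun ω ω' h => ?_
  have h1 := history_succ_factorsThrough k h
  simp only [Prod.mk.injEq] at h1
  rw [h1.2.1, h1.2.2, process_factorsThrough k h1.1]

/-- If `f` grows in one step by at most `φ`, up to a quadratic and a linear term in the noise,
then the linear term vanishes in expectation. -/
lemma integral_process_succ_le (hS : Sampling μ b A B) (hb : 1 ≤ b) (hbn : b ≤ n) (k : ℕ)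
    {f φ : State n p → ℝ} {c : ℝ} (hc : 0 ≤ c) {u : State n p → EuclideanSpace ℝ (Fin p)}
    (h : ∀ ω, f (process G β x0 A B (k + 1) ω) ≤ φ (process G β x0 A B k ω)
      + c * ‖noise G k (B k ω) (process G β x0 A B k ω)‖ ^ 2
      + inner ℝ (u (process G β x0 A B k ω)) (noise G k (B k ω) (process G β x0 A B k ω))) :
    ∫ ω, f (process G β x0 A B (k + 1) ω) ∂μ ≤ ∫ ω, φ (process G β x0 A B k ω) ∂μ
      + c * (1 / b * (2 * k ^ 2 *
          ∫ ω, compDist G (process G β x0 A B k ω).cur (process G β x0 A B k ω).prev ∂μ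
        + 18 * ∫ ω, tableError G (process G β x0 A B k ω) ∂μ)) := by
  have hi := fun φ => integrable_process (G := G) (β := β) (x0 := x0) hS k φ
  calc ∫ ω, f (process G β x0 A B (k + 1) ω) ∂μ
      ≤ ∫ ω, (φ (process G β x0 A B k ω)
        + c * ‖noise G k (B k ω) (process G β x0 A B k ω)‖ ^ 2
        + inner ℝ (u (process G β x0 A B k ω))
            (noise G k (B k ω) (process G β x0 A B k ω))) ∂μ :=
        integral_mono (integrable_process hS (k + 1) f)
          (integrable_process_batches hS k fun _ s σ =>
            φ σ + c * ‖noise G k s σ‖ ^ 2 + inner ℝ (u σ) (noise G k s σ)) h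
    _ = ∫ ω, batchMean b (fun s => φ (process G β x0 A B k ω)
        + c * ‖noise G k s (process G β x0 A B k ω)‖ ^ 2
        + inner ℝ (u (process G β x0 A B k ω)) (noise G k s (process G β x0 A B k ω))) ∂μ :=
        hS.integral_comp_B hbn k
          (F := fun s ω => φ (process G β x0 A B k ω)
            + c * ‖noise G k s (process G β x0 A B k ω)‖ ^ 2
            + inner ℝ (u (process G β x0 A B k ω)) (noise G k s (process G β x0 A B k ω)))
          fun s => (process_factorsThrough k).comp_left
            fun σ => φ σ + c * ‖noise G k s σ‖ ^ 2 + inner ℝ (u σ) (noise G k s σ)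
    _ ≤ ∫ ω, (φ (process G β x0 A B k ω) + c * (1 / b * (2 * k ^ 2 *
          compDist G (process G β x0 A B k ω).cur (process G β x0 A B k ω).prev
          + 18 * tableError G (process G β x0 A B k ω)))) ∂μ := by
        refine integral_mono (hi fun σ => batchMean b fun s =>
            φ σ + c * ‖noise G k s σ‖ ^ 2 + inner ℝ (u σ) (noise G k s σ))
          (hi fun σ => φ σ + c * (1 / b * (2 * k ^ 2 * compDist G σ.cur σ.prev
            + 18 * tableError G σ))) fun ω => ?_
        simp only
        rw [batchMean_add, batchMean_add, batchMean_const hbn, batchMean_mul_left,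
          batchMean_inner_noise hb hbn, add_zero]
        gcongr
        exact batchMean_norm_noise_sq_le hb hbn _
    _ = _ := by
        rw [integral_add (hi φ) (hi fun σ => c * (1 / b * (2 * k ^ 2 * compDist G σ.cur σ.prev
            + 18 * tableError G σ))), integral_const_mul, integral_const_mul,
          integral_add (hi fun σ => 2 * k ^ 2 * compDist G σ.cur σ.prev)
            (hi fun σ => 18 * tableError G σ), integral_const_mul, integral_const_mul]

lemma integral_tableError_succ_le (hS : Sampling μ b A B) (hb : 1 ≤ b) (hbn : b ≤ n) (k : ℕ) :
    ∫ ω, tableError G (process G β x0 A B (k + 1) ω) ∂μ ≤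
      (1 - b / n / 2) * ∫ ω, tableError G (process G β x0 A B k ω) ∂μ
      + 2 / (b / n) * ∫ ω, compDist G (process G β x0 A B (k + 1) ω).cur
          (process G β x0 A B (k + 1) ω).prev ∂μ := by
  have hb0 : (0 : ℝ) < b := by exact_mod_cast hb
  have hn0 : (0 : ℝ) < n := by exact_mod_cast (by omega : 0 < n)
  have ha0 : (0 : ℝ) < b / n := by positivity
  have ha1 : (b / n : ℝ) ≤ 1 := by
    rw [div_le_one hn0]; exact_mod_cast hbn
  -- With a = b/n, the Young parameter a/(2(1-a)) gives (1+c)(1-a) = 1 - a/2. For a = 1 the factor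
  -- 1-a is zero and c = 1 suffices.
  obtain ⟨c, hc, h1, h2⟩ : ∃ c : ℝ, 0 < c ∧ (1 + c) * (1 - b / n) ≤ 1 - b / n / 2 ∧
      1 + 1 / c ≤ 2 / (b / n : ℝ) := by
    set a : ℝ := b / n
    rcases ha1.eq_or_lt with h | h
    · exact ⟨1, one_pos, by rw [h]; norm_num, by rw [h]; norm_num⟩
    · have h' : 0 < 1 - a := by linarith
      refine ⟨a / (2 * (1 - a)), by positivity, le_of_eq ?_, ?_⟩
      · field_simp; ring
      · have : 1 + 1 / (a / (2 * (1 - a))) = 2 / a - 1 := by field_simp; ring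
        rw [this]; linarith
  have hi := fun φ => integrable_process (G := G) (β := β) (x0 := x0) hS k φ
  have hi' := fun φ => integrable_process (G := G) (β := β) (x0 := x0) hS (k + 1) φ
  have hA := hS.integral_comp_A hbn k (F := fun s ω => 1 / (n : ℝ) * ∑ i, if i ∈ s then 0 else
      ‖G i (process G β x0 A B k ω).cur - (process G β x0 A B k ω).table i‖ ^ 2)
    fun s => (process_factorsThrough k).comp_left fun σ => 1 / (n : ℝ) * ∑ i, if i ∈ s then 0 else
      ‖G i σ.cur - σ.table i‖ ^ 2
  have hiA := integrable_process_batches (G := G) (β := β) (x0 := x0) hS k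
    fun s _ σ => (1 + c) * (1 / (n : ℝ) * ∑ i, if i ∈ s then 0 else
      ‖G i σ.cur - σ.table i‖ ^ 2)
  have hV0 : 0 ≤ ∫ ω, tableError G (process G β x0 A B k ω) ∂μ :=
    integral_nonneg fun ω => tableError_nonneg _
  have hU0 : 0 ≤ ∫ ω, compDist G (process G β x0 A B (k + 1) ω).cur
      (process G β x0 A B (k + 1) ω).prev ∂μ :=
    integral_nonneg fun ω => compDist_nonneg _ _
  calc ∫ ω, tableError G (process G β x0 A B (k + 1) ω) ∂μ
      ≤ ∫ ω, ((1 + c) * (1 / (n : ℝ) * ∑ i, if i ∈ A k ω then 0 else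
        ‖G i (process G β x0 A B k ω).cur - (process G β x0 A B k ω).table i‖ ^ 2)
        + (1 + 1 / c) * compDist G (process G β x0 A B (k + 1) ω).cur
          (process G β x0 A B (k + 1) ω).prev) ∂μ :=
        integral_mono (hi' _) (hiA.add (hi' fun σ => (1 + 1 / c) * compDist G σ.cur σ.prev))
          fun ω => tableError_state_succ_le hc k
    _ = (1 + c) * ((1 - b / n) * ∫ ω, tableError G (process G β x0 A B k ω) ∂μ)
        + (1 + 1 / c) * ∫ ω, compDist G (process G β x0 A B (k + 1) ω).cur
          (process G β x0 A B (k + 1) ω).prev ∂μ := by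
        rw [integral_add hiA (hi' fun σ => (1 + 1 / c) * compDist G σ.cur σ.prev),
          integral_const_mul (1 + c), hA, integral_const_mul (1 + 1 / c)]
        simp only [batchMean_tableError hb hbn]
        rw [integral_const_mul]
    _ ≤ _ := by
        rw [← mul_assoc]
        gcongr

variable {L : ℝ} {xs : EuclideanSpace ℝ (Fin p)}

/-- The energy of a state. -/
noncomputable def State.energy (G : Fin n → EuclideanSpace ℝ (Fin p) → EuclideanSpace ℝ (Fin p))
    (β : ℝ) (xs : EuclideanSpace ℝ (Fin p)) (k : ℕ) (σ : State n p) : ℝ :=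
  VFKM.energy (2 * β) k (σ.cur - xs) (σ.cur - σ.prev) (avg G σ.prev)

/-- The squared length of the increment of a state. -/
noncomputable def State.incrSq (σ : State n p) : ℝ := ‖σ.cur - σ.prev‖ ^ 2

/-- The squared length of `x^k - x^{k-1} + 2 β G x^{k-1}`. -/
noncomputable def State.resSq (G : Fin n → EuclideanSpace ℝ (Fin p) → EuclideanSpace ℝ (Fin p))
    (β : ℝ) (σ : State n p) : ℝ := ‖σ.cur - σ.prev + (2 * β) • avg G σ.prev‖ ^ 2

/-- Co-coercivity and Jensen's inequality measure the descent in component differences, the quantity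
that also bounds the variance of the noise. -/
lemma cocoercive_descent (hG : AvgCocoercive G L) (hn : n ≠ 0) (hβ : 0 ≤ β)
    (x y : EuclideanSpace ℝ (Fin p)) :
    4 * β * (1 / L - β) * compDist G x y ≤
      2 * (2 * β) * inner ℝ (x - y) (avg G x - avg G y)
        - (2 * β) ^ 2 * ‖avg G x - avg G y‖ ^ 2 := by
  have h1 := hG.compDist_le x y
  have h2 := norm_avg_sub_sq_le (G := G) hn x y
  have h3 := mul_le_mul_of_nonneg_left h1 (by positivity : 0 ≤ 4 * β)
  have h4 := mul_le_mul_of_nonneg_left h2 (by positivity : 0 ≤ 4 * β ^ 2)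
  linarith

/-- At h = 2β the noise weight 3/2 h² is 6β². The descent relative to x⋆ is dropped; the one
relative to x^{k-1} is kept to pay for the noise. -/
lemma integral_energy_succ_le (hS : Sampling μ b A B) (hb : 1 ≤ b) (hbn : b ≤ n)
    (hG : AvgCocoercive G L) (hxs : avg G xs = 0) (hβ : 0 ≤ β) (hβL : β ≤ 1 / L)
    (k : ℕ) :
    ∫ ω, (process G β x0 A B (k + 1) ω).energy G β xs (k + 1) ∂μ
      + 7 / 8 * (k + 3) * ∫ ω, (process G β x0 A B (k + 1) ω).resSq G β ∂μ
      ≤ ∫ ω, (process G β x0 A B k ω).energy G β xs k ∂μ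
      - k * (k + 3) * (β * (1 / L - β)) *
          ∫ ω, compDist G (process G β x0 A B k ω).cur (process G β x0 A B k ω).prev ∂μ
      + 6 * β ^ 2 * (1 / b * (2 * k ^ 2 *
          ∫ ω, compDist G (process G β x0 A B k ω).cur (process G β x0 A B k ω).prev ∂μ
        + 18 * ∫ ω, tableError G (process G β x0 A B k ω) ∂μ)) := by
  have hn : n ≠ 0 := by omega
  have hi := fun φ => integrable_process (G := G) (β := β) (x0 := x0) hS k φ
  have hi' := fun φ => integrable_process (G := G) (β := β) (x0 := x0) hS (k + 1) φ
  have key := integral_process_succ_le (G := G) (β := β) (x0 := x0) hS hb hbn k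
    (f := fun σ => σ.energy G β xs (k + 1) + 7 / 8 * (k + 3) * σ.resSq G β)
    (φ := fun σ => σ.energy G β xs k
      - k * (k + 3) * (β * (1 / L - β)) * compDist G σ.cur σ.prev)
    (c := 6 * β ^ 2) (by positivity)
    (u := fun σ => -(2 * β) • ((2 : ℝ) • (σ.cur - xs)
      + (k : ℝ) • (σ.cur - σ.prev + (2 * β) • avg G σ.prev)
      + (1 / 2 * ((k : ℝ) + 3)) • (σ.cur - σ.prev - (2 * β) • (avg G σ.cur - avg G σ.prev))))
    (by
      intro ω
      have hrec := state_succ_rec (G := G) (β := β) (x0 := x0) (A := fun j => A j ω)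
        (B := fun j => B j ω) k
      have hp : (process G β x0 A B (k + 1) ω).prev = (process G β x0 A B k ω).cur := rfl
      change ((k : ℝ) + 5) • ((process G β x0 A B (k + 1) ω).cur - (process G β x0 A B k ω).cur)
        = (k : ℝ) • ((process G β x0 A B k ω).cur - (process G β x0 A B k ω).prev)
        - (2 * β) • (((k : ℝ) + 3) • avg G (process G β x0 A B k ω).cur
            - (k : ℝ) • avg G (process G β x0 A B k ω).prev)
        - (2 * β) • noise G k (B k ω) (process G β x0 A B k ω) at hrec
      simp only [State.energy, State.resSq, hp]
      set y := (process G β x0 A B (k + 1) ω).cur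
      set σ := process G β x0 A B k ω
      have h1 := energy_step (X := σ.cur - xs) (fun hk => by simp [noise, hk]) hrec
      have e : σ.cur - xs + (y - σ.cur) = y - xs := by abel
      rw [e] at h1
      have h2 := cocoercive_descent hG hn hβ σ.cur σ.prev
      have h3 := cocoercive_descent hG hn hβ σ.cur xs
      rw [hxs, sub_zero] at h3
      have h4 : 0 ≤ 4 * β * (1 / L - β) * compDist G σ.cur xs :=
        mul_nonneg (mul_nonneg (by positivity) (by linarith)) (compDist_nonneg _ _)
      have hk : 0 ≤ 1 / 4 * ((k : ℝ) * (k + 3)) := by positivity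
      have h5 := mul_le_mul_of_nonneg_left h2 hk
      rw [inner_smul_left]
      simp only [conj_trivial]
      have h6 : 0 ≤ 2 * ((2 * (2 * β)) * inner ℝ (σ.cur - xs) (avg G σ.cur)
          - (2 * β) ^ 2 * ‖avg G σ.cur‖ ^ 2) := by linarith
      have h7 : 0 ≤ 4 * (2 * β) * inner ℝ (σ.cur - xs) (avg G σ.cur)
          - 2 * (2 * β) ^ 2 * ‖avg G σ.cur‖ ^ 2 := by linarith
      linarith)
  rw [integral_add (hi' fun σ => σ.energy G β xs (k + 1))
      (hi' fun σ => 7 / 8 * ((k : ℝ) + 3) * σ.resSq G β), integral_const_mul,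
    integral_sub (hi fun σ => σ.energy G β xs k)
      (hi fun σ => k * (k + 3) * (β * (1 / L - β)) * compDist G σ.cur σ.prev),
    integral_const_mul] at key
  exact key

lemma integral_incrSq_succ_le (hS : Sampling μ b A B) (hb : 1 ≤ b) (hbn : b ≤ n)
    (hG : AvgCocoercive G L) (hβ : 0 ≤ β) (hβL : β ≤ 1 / L) (k : ℕ) :
    ((k : ℝ) + 1) ^ 2 * ∫ ω, (process G β x0 A B (k + 1) ω).incrSq ∂μ
      + (k + 1) * ∫ ω, (process G β x0 A B (k + 1) ω).incrSq ∂μ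
      ≤ (k : ℝ) ^ 2 * ∫ ω, (process G β x0 A B k ω).incrSq ∂μ
      + 4 * β ^ 2 * (1 / b * (2 * k ^ 2 *
          ∫ ω, compDist G (process G β x0 A B k ω).cur (process G β x0 A B k ω).prev ∂μ
        + 18 * ∫ ω, tableError G (process G β x0 A B k ω) ∂μ))
      + 9 * (k + 2) * ∫ ω, (process G β x0 A B (k + 1) ω).resSq G β ∂μ := by
  have hn : n ≠ 0 := by omega
  have hi' := fun φ => integrable_process (G := G) (β := β) (x0 := x0) hS (k + 1) φ
  have key := integral_process_succ_le (G := G) (β := β) (x0 := x0) hS hb hbn k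
    (f := fun σ => (((k : ℝ) + 1) ^ 2 + (k + 1)) * σ.incrSq - 9 * (k + 2) * σ.resSq G β)
    (φ := fun σ => (k : ℝ) ^ 2 * σ.incrSq)
    (c := 4 * β ^ 2) (by positivity)
    (u := fun σ => -(2 * k * (2 * β)) •
      (σ.cur - σ.prev - (2 * β) • (avg G σ.cur - avg G σ.prev)))
    (by
      intro ω
      have hrec := state_succ_rec (G := G) (β := β) (x0 := x0) (A := fun j => A j ω)
        (B := fun j => B j ω) k
      have hp : (process G β x0 A B (k + 1) ω).prev = (process G β x0 A B k ω).cur := rfl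
      change ((k : ℝ) + 5) • ((process G β x0 A B (k + 1) ω).cur - (process G β x0 A B k ω).cur)
        = (k : ℝ) • ((process G β x0 A B k ω).cur - (process G β x0 A B k ω).prev)
        - (2 * β) • (((k : ℝ) + 3) • avg G (process G β x0 A B k ω).cur
            - (k : ℝ) • avg G (process G β x0 A B k ω).prev)
        - (2 * β) • noise G k (B k ω) (process G β x0 A B k ω) at hrec
      simp only [State.incrSq, State.resSq, hp]
      set y := (process G β x0 A B (k + 1) ω).cur
      set σ := process G β x0 A B k ω
      have h1 := increment_step hrec
      have h2 := cocoercive_descent hG hn hβ σ.cur σ.prev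
      have h4 : 0 ≤ 4 * β * (1 / L - β) * compDist G σ.cur σ.prev :=
        mul_nonneg (mul_nonneg (by positivity) (by linarith)) (compDist_nonneg _ _)
      have h5 := mul_nonneg (sq_nonneg (k : ℝ)) (h4.trans h2)
      rw [inner_smul_left]
      simp only [conj_trivial]
      linarith)
  rw [integral_sub (hi' fun σ => (((k : ℝ) + 1) ^ 2 + (k + 1)) * σ.incrSq)
      (hi' fun σ => 9 * ((k : ℝ) + 2) * σ.resSq G β), integral_const_mul, integral_const_mul,
    integral_const_mul] at key
  linarith

lemma integral_resSq_succ_le (hS : Sampling μ b A B) (hb : 1 ≤ b) (hbn : b ≤ n) (k : ℕ) :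
    ((k : ℝ) + 1) ^ 2 * ∫ ω, (process G β x0 A B (k + 1) ω).resSq G β ∂μ
      ≤ (k : ℝ) ^ 2 * ∫ ω, (process G β x0 A B k ω).resSq G β ∂μ
      + 4 * β ^ 2 * (1 / b * (2 * k ^ 2 *
          ∫ ω, compDist G (process G β x0 A B k ω).cur (process G β x0 A B k ω).prev ∂μ
        + 18 * ∫ ω, tableError G (process G β x0 A B k ω) ∂μ))
      + 4 * (k + 3) * ∫ ω, (process G β x0 A B (k + 1) ω).incrSq ∂μ := by
  have hi' := fun φ => integrable_process (G := G) (β := β) (x0 := x0) hS (k + 1) φ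
  have key := integral_process_succ_le (G := G) (β := β) (x0 := x0) hS hb hbn k
    (f := fun σ => ((k : ℝ) + 1) ^ 2 * σ.resSq G β - 4 * (k + 3) * σ.incrSq)
    (φ := fun σ => (k : ℝ) ^ 2 * σ.resSq G β)
    (c := 4 * β ^ 2) (by positivity)
    (u := fun σ => -(2 * k * (2 * β)) • (σ.cur - σ.prev + (2 * β) • avg G σ.prev))
    (by
      intro ω
      have hrec := state_succ_rec (G := G) (β := β) (x0 := x0) (A := fun j => A j ω)
        (B := fun j => B j ω) k
      have hp : (process G β x0 A B (k + 1) ω).prev = (process G β x0 A B k ω).cur := rfl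
      change ((k : ℝ) + 5) • ((process G β x0 A B (k + 1) ω).cur - (process G β x0 A B k ω).cur)
        = (k : ℝ) • ((process G β x0 A B k ω).cur - (process G β x0 A B k ω).prev)
        - (2 * β) • (((k : ℝ) + 3) • avg G (process G β x0 A B k ω).cur
            - (k : ℝ) • avg G (process G β x0 A B k ω).prev)
        - (2 * β) • noise G k (B k ω) (process G β x0 A B k ω) at hrec
      simp only [State.incrSq, State.resSq, hp]
      set y := (process G β x0 A B (k + 1) ω).cur
      set σ := process G β x0 A B k ω
      have h1 := residual_step hrec
      rw [inner_smul_left]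
      simp only [conj_trivial]
      linarith)
  rw [integral_sub (hi' fun σ => ((k : ℝ) + 1) ^ 2 * σ.resSq G β)
      (hi' fun σ => 4 * ((k : ℝ) + 3) * σ.incrSq), integral_const_mul, integral_const_mul,
    integral_const_mul] at key
  linarith

end RandomState

/-! ### Real sequences and constants -/

section Sequences

/-- A nonnegative sequence with summable increases converges to `0` if its quotients by `k` are
summable. -/
lemma tendsto_zero_of_le_add_summable {u s : ℕ → ℝ} (hu : ∀ k, 0 ≤ u k) (hs : Summable s)
    (h : ∀ k, u (k + 1) ≤ u k + s k) (hdiv : Summable fun k : ℕ => u (k + 1) / ((k : ℝ) + 1)) :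
    Tendsto u atTop (𝓝 0) := by
  have hanti : Antitone fun k => u k - ∑ j ∈ range k, s j := by
    refine antitone_nat_of_succ_le fun k => ?_
    rw [sum_range_succ]
    linarith [h k]
  have hsum := hs.hasSum.tendsto_sum_nat
  obtain ⟨C, hC⟩ := hsum.bddAbove_range
  have hbdd : BddBelow (Set.range fun k => u k - ∑ j ∈ range k, s j) := by
    refine ⟨-C, ?_⟩
    rintro _ ⟨k, rfl⟩
    have := hC ⟨k, rfl⟩
    simp only at this ⊢
    linarith [hu k]
  obtain ⟨l, hl⟩ : ∃ l, Tendsto u atTop (𝓝 l) := by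
    have h1 := (tendsto_atTop_ciInf hanti hbdd).add hsum
    exact ⟨_, h1.congr fun k => by ring⟩
  have hl0 : 0 ≤ l := ge_of_tendsto' hl hu
  rcases hl0.eq_or_lt with h0 | hpos
  · rwa [← h0] at hl
  -- A positive limit would bound the quotients below by a multiple of 1/(k+1), and the harmonic
  -- series would converge.
  exfalso
  have hev : ∀ᶠ k in atTop, l / 2 < u (k + 1) :=
    ((tendsto_add_atTop_iff_nat 1).2 hl).eventually_const_lt (by linarith)
  have h2 : Summable fun k : ℕ => l / 2 * (1 / ((k : ℝ) + 1)) := by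
    refine Summable.of_norm_bounded_eventually_nat hdiv ?_
    filter_upwards [hev] with k hk
    rw [Real.norm_of_nonneg (by positivity), mul_one_div]
    gcongr
  have h3 : Summable fun k : ℕ => 1 / ((k : ℝ) + 1) :=
    (summable_mul_left_iff (by positivity)).1 h2
  have h4 : Summable fun k : ℕ => 1 / ((k : ℝ)) := by
    rw [← summable_nat_add_iff 1]
    simpa using h3
  exact Real.not_summable_one_div_natCast h4

variable {e d q U V : ℕ → ℝ} {a κ δ : ℝ}

/-- Summing the contraction gives (a/2) ∑ V ≤ (2/a) ∑ U. The induction carries the last term (1 -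
a/2) V_K, which the next step consumes. -/
lemma sum_tableError_le (ha : 0 < a) (ha1 : a ≤ 1) (hU : ∀ k, 0 ≤ U k) (hV : ∀ k, 0 ≤ V k)
    (hV0 : V 0 = 0) (h : ∀ k, V (k + 1) ≤ (1 - a / 2) * V k + 2 / a * U (k + 1)) (K : ℕ) :
    ∑ k ∈ range K, V k ≤ 4 / a ^ 2 * ∑ k ∈ range K, U k := by
  have key : ∀ K, a / 2 * ∑ k ∈ range (K + 1), V k + (1 - a / 2) * V K
      ≤ 2 / a * ∑ k ∈ range (K + 1), U k := by
    intro K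
    induction K with
    | zero =>
      have : 0 ≤ 2 / a * U 0 := mul_nonneg (by positivity) (hU 0)
      simpa [hV0] using this
    | succ K ih =>
      rw [sum_range_succ _ (K + 1), sum_range_succ _ (K + 1)]
      have := h K
      linarith
  rcases K with _ | K
  · simp
  have h1 := key K
  have h2 : 0 ≤ (1 - a / 2) * V K := mul_nonneg (by linarith) (hV K)
  have h3 : a / 2 * ∑ k ∈ range (K + 1), V k ≤ 2 / a * ∑ k ∈ range (K + 1), U k := by linarith
  have h4 := mul_le_mul_of_nonneg_left h3 (by positivity : 0 ≤ 2 / a)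
  calc ∑ k ∈ range (K + 1), V k = 2 / a * (a / 2 * ∑ k ∈ range (K + 1), V k) := by
        field_simp
    _ ≤ _ := h4
    _ = _ := by ring

/-- The consequences of the expected one-step estimates. -/
lemma rates_of_step {c c' m : ℝ} (he : ∀ k, 0 ≤ e k) (hd : ∀ k, 0 ≤ d k) (hq : ∀ k, 0 ≤ q k)
    (hU : ∀ k, 0 ≤ U k) (hV : ∀ k, 0 ≤ V k) (hU0 : U 0 = 0) (hV0 : V 0 = 0)
    (ha : 0 < a) (ha1 : a ≤ 1) (hc : 0 < c) (hc' : 0 ≤ c') (hm : 0 ≤ m) (hδ : 0 < δ)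
    (hstep : ∀ k : ℕ, e (k + 1) + 7 / 8 * (k + 3) * q (k + 1) ≤ e k - k * (k + 3) * κ * U k
      + c * (m * (2 * k ^ 2 * U k + 18 * V k)))
    (hVstep : ∀ k, V (k + 1) ≤ (1 - a / 2) * V k + 2 / a * U (k + 1))
    (hcoef : ∀ k : ℕ, 1 ≤ k →
      c * (m * (2 * k ^ 2 + 72 / a ^ 2)) + δ * (k * (k + 3)) ≤ k * (k + 3) * κ)
    (hdstep : ∀ k : ℕ, ((k : ℝ) + 1) ^ 2 * d (k + 1) + (k + 1) * d (k + 1) ≤ (k : ℝ) ^ 2 * d k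
      + c' * (m * (2 * k ^ 2 * U k + 18 * V k)) + 9 * (k + 2) * q (k + 1))
    (hqstep : ∀ k : ℕ, ((k : ℝ) + 1) ^ 2 * q (k + 1) ≤ (k : ℝ) ^ 2 * q k
      + c' * (m * (2 * k ^ 2 * U k + 18 * V k)) + 4 * (k + 3) * d (k + 1)) :
    (∀ k, e k ≤ e 0) ∧ Tendsto (fun k : ℕ => (k : ℝ) ^ 2 * d k) atTop (𝓝 0) ∧
      Tendsto (fun k : ℕ => (k : ℝ) ^ 2 * q k) atTop (𝓝 0) := by
  set W : ℕ → ℝ := fun k => m * (2 * k ^ 2 * U k + 18 * V k) with hW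
  have hW0 : ∀ k, 0 ≤ W k := fun k => by
    have := hU k
    have := hV k
    positivity
  -- Replacing ∑ V by (4/a²) ∑ U turns 18 V into 72/a² U, and `hcoef` then compares term by term.
  -- The term k = 0 vanishes because U 0 = 0.
  have hWsum : ∀ K, ∑ k ∈ range K, c * W k ≤ ∑ k ∈ range K, (k * (k + 3) * κ * U k
      - δ * (k * (k + 3) * U k)) := by
    intro K
    have h1 := sum_tableError_le ha ha1 hU hV hV0 hVstep K
    calc ∑ k ∈ range K, c * W k
        = ∑ k ∈ range K, c * (m * (2 * k ^ 2 * U k)) + c * m * 18 * ∑ k ∈ range K, V k := by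
          rw [mul_sum, ← sum_add_distrib]
          refine sum_congr rfl fun k _ => ?_
          simp only [hW]
          ring
      _ ≤ ∑ k ∈ range K, c * (m * (2 * k ^ 2 * U k))
          + c * m * 18 * (4 / a ^ 2 * ∑ k ∈ range K, U k) := by gcongr
      _ = ∑ k ∈ range K, c * (m * (2 * k ^ 2 + 72 / a ^ 2)) * U k := by
          rw [mul_sum, mul_sum, ← sum_add_distrib]
          refine sum_congr rfl fun k _ => ?_
          ring
      _ ≤ _ := by
          refine sum_le_sum fun k _ => ?_
          rcases Nat.eq_zero_or_pos k with h0 | hk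
          · subst h0; simp [hU0]
          · have := mul_le_mul_of_nonneg_right (hcoef k hk) (hU k)
            linarith
  have htel : ∀ K, e K + ∑ k ∈ range K, 7 / 8 * ((k : ℝ) + 3) * q (k + 1) ≤ e 0
      + ∑ k ∈ range K, (c * W k - k * (k + 3) * κ * U k) := by
    intro K
    induction K with
    | zero => simp
    | succ K ih =>
      rw [sum_range_succ, sum_range_succ]
      have := hstep K
      simp only [hW] at ih ⊢
      linarith
  have hmain : ∀ K, e K + ∑ k ∈ range K, 7 / 8 * ((k : ℝ) + 3) * q (k + 1)
      + δ * ∑ k ∈ range K, (k * (k + 3) * U k) ≤ e 0 := by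
    intro K
    have h1 := htel K
    have h2 := hWsum K
    rw [sum_sub_distrib] at h1 h2
    rw [← mul_sum _ _ δ] at h2
    linarith
  have hqn : ∀ k : ℕ, 0 ≤ ((k : ℝ) + 3) * q (k + 1) := fun k => mul_nonneg (by positivity) (hq _)
  have hUn : ∀ k : ℕ, 0 ≤ (k : ℝ) * (k + 3) * U k := fun k => mul_nonneg (by positivity) (hU _)
  have hq78 : ∀ K, ∑ k ∈ range K, 7 / 8 * ((k : ℝ) + 3) * q (k + 1)
      = 7 / 8 * ∑ k ∈ range K, ((k : ℝ) + 3) * q (k + 1) := fun K => by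
    rw [mul_sum]; exact sum_congr rfl fun k _ => by ring
  have hsq0 : ∀ K, 0 ≤ ∑ k ∈ range K, ((k : ℝ) + 3) * q (k + 1) := fun K =>
    sum_nonneg fun k _ => hqn k
  have hsU0 : ∀ K, 0 ≤ ∑ k ∈ range K, (k : ℝ) * (k + 3) * U k := fun K =>
    sum_nonneg fun k _ => hUn k
  have hSq : Summable fun k : ℕ => ((k : ℝ) + 3) * q (k + 1) := by
    refine summable_of_sum_range_le (c := 8 / 7 * e 0) hqn fun K => ?_
    have h1 := hmain K
    rw [hq78] at h1
    have h2 := mul_nonneg hδ.le (hsU0 K)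
    linarith [he K]
  have hSU : Summable fun k : ℕ => (k : ℝ) * (k + 3) * U k := by
    refine summable_of_sum_range_le (c := e 0 / δ) hUn fun K => ?_
    have h1 := hmain K
    rw [hq78] at h1
    rw [le_div_iff₀ hδ]
    linarith [he K, hsq0 K]
  have hSW : Summable W := by
    have hS2 : Summable fun k : ℕ => (k : ℝ) * (k + 3) * κ * U k - δ * (k * (k + 3) * U k) :=
      (hSU.mul_left (κ - δ)).congr fun k => by ring
    have hκδ : ∀ k : ℕ, 0 ≤ (k : ℝ) * (k + 3) * κ * U k - δ * (k * (k + 3) * U k) := by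
      intro k
      rcases Nat.eq_zero_or_pos k with h0 | hk
      · subst h0; simp
      · have h1 := mul_le_mul_of_nonneg_right (hcoef k hk) (hU k)
        have h2 : 0 ≤ c * (m * (2 * k ^ 2 + 72 / a ^ 2)) * U k :=
          mul_nonneg (by positivity) (hU k)
        linarith
    have : Summable fun k => c * W k :=
      summable_of_sum_range_le (fun k => mul_nonneg hc.le (hW0 k)) fun K =>
        (hWsum K).trans (hS2.sum_le_tsum _ fun k _ => hκδ k)
    exact (summable_mul_left_iff hc.ne').1 this
  have hSd : Summable fun k : ℕ => ((k : ℝ) + 1) * d (k + 1) := by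
    have hS3 : Summable fun k : ℕ => c' * W k + 9 * (((k : ℝ) + 3) * q (k + 1)) :=
      (hSW.mul_left c').add (hSq.mul_left 9)
    refine summable_of_sum_range_le (c := ∑' k : ℕ, (c' * W k + 9 * (((k : ℝ) + 3) * q (k + 1))))
      (fun k => mul_nonneg (by positivity) (hd _)) fun K => ?_
    refine le_trans ?_ (hS3.sum_le_tsum (range K) fun k _ =>
      add_nonneg (mul_nonneg hc' (hW0 k)) (mul_nonneg (by norm_num) (hqn k)))
    -- Telescoping `hdstep` accumulates its surplus term (k+1) d(k+1).
    have : (K : ℝ) ^ 2 * d K + ∑ k ∈ range K, ((k : ℝ) + 1) * d (k + 1)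
        ≤ ∑ k ∈ range K, (c' * W k + 9 * (((k : ℝ) + 3) * q (k + 1))) := by
      induction K with
      | zero => simp
      | succ K ih =>
        rw [sum_range_succ, sum_range_succ]
        have h1 := hdstep K
        have h2 := hq (K + 1)
        simp only [hW] at ih ⊢
        push_cast
        linarith
    have h0 : 0 ≤ (K : ℝ) ^ 2 * d K := mul_nonneg (by positivity) (hd K)
    linarith
  refine ⟨fun K => ?_, ?_, ?_⟩
  · have h1 := hmain K
    rw [hq78] at h1
    have h2 := mul_nonneg hδ.le (hsU0 K)
    linarith [hsq0 K]
  · refine tendsto_zero_of_le_add_summable (s := fun k => c' * W k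
      + 9 * (((k : ℝ) + 3) * q (k + 1))) (fun k => mul_nonneg (by positivity) (hd k))
      ((hSW.mul_left c').add (hSq.mul_left 9)) (fun k => ?_) (hSd.congr fun k => ?_)
    · have h1 := hdstep k
      have h2 := hq (k + 1)
      have h3 : 0 ≤ ((k : ℝ) + 1) * d (k + 1) := mul_nonneg (by positivity) (hd _)
      simp only [hW]
      push_cast
      linarith
    · push_cast
      field_simp
  · have hSd4 : Summable fun k : ℕ => 12 * (((k : ℝ) + 1) * d (k + 1)) := hSd.mul_left 12
    refine tendsto_zero_of_le_add_summable (s := fun k => c' * W k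
      + 12 * (((k : ℝ) + 1) * d (k + 1))) (fun k => mul_nonneg (by positivity) (hq k))
      ((hSW.mul_left c').add hSd4) (fun k => ?_) ?_
    · have h1 := hqstep k
      have h3 : 0 ≤ (k : ℝ) * d (k + 1) := mul_nonneg (by positivity) (hd _)
      simp only [hW]
      push_cast
      linarith
    · refine Summable.of_nonneg_of_le (fun k => ?_) (fun k => ?_) hSq
      · have := hq (k + 1); positivity
      · have h2 := hq (k + 1)
        have : (((k + 1 : ℕ) : ℝ)) ^ 2 * q (k + 1) / ((k : ℝ) + 1) = ((k : ℝ) + 1) * q (k + 1) := by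
          push_cast; field_simp
        rw [this]
        gcongr
        norm_num

end Sequences

/-! ### Arithmetic of the step size and of the constants of the rates. -/

section Constants

variable {b n L β : ℝ}

lemma step_size_identity (hb : 0 < b) (hn : 0 < n) (hL : 0 < L)
    (hβ : β = b ^ 3 / (2 * L * (b ^ 3 + 64 * n ^ 2))) :
    0 < β ∧ L * β * (1 + 64 * (n ^ 2 / b ^ 3)) = 1 / 2 ∧ β ≤ 1 / L := by
  have h0 : 0 < b ^ 3 + 64 * n ^ 2 := by positivity
  refine ⟨by rw [hβ]; positivity, by rw [hβ]; field_simp, ?_⟩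
  rw [hβ, div_le_div_iff₀ (by positivity) hL]
  have : 0 ≤ L * (b ^ 3 + 128 * n ^ 2) := by positivity
  linarith

/-- After a common factor is removed and b² ≤ n² is used, what remains besides a nonnegative b³ term
is 12k² + 432 ≤ 112 k(k+3), which at k = 1 reads 444 ≤ 448. The reserve β/(8L) later makes k² U_k
summable. -/
lemma noise_coefficient_le (hb : 0 < b) (hbn : b ≤ n) (hL : 0 < L)
    (hβ : β = b ^ 3 / (2 * L * (b ^ 3 + 64 * n ^ 2))) {k : ℝ} (hk : 1 ≤ k) :
    6 * β ^ 2 * (1 / b * (2 * k ^ 2 + 72 / (b / n) ^ 2)) + β / (8 * L) * (k * (k + 3))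
      ≤ k * (k + 3) * (β * (1 / L - β)) := by
  have hn : 0 < n := hb.trans_le hbn
  set M := b ^ 3 + 64 * n ^ 2 with hM
  have hM0 : 0 < M := by positivity
  have e1 : 6 * β ^ 2 * (1 / b * (2 * k ^ 2 + 72 / (b / n) ^ 2)) + β / (8 * L) * (k * (k + 3))
      = b ^ 3 / (4 * L ^ 2 * M ^ 2) *
        (12 * k ^ 2 * b ^ 2 + 432 * n ^ 2 + M / 4 * (k * (k + 3))) := by
    rw [hβ]; field_simp; ring
  have e2 : k * (k + 3) * (β * (1 / L - β))
      = b ^ 3 / (4 * L ^ 2 * M ^ 2) * (k * (k + 3) * (2 * M - b ^ 3)) := by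
    rw [hβ]; field_simp; ring
  rw [e1, e2]
  refine mul_le_mul_of_nonneg_left ?_ (by positivity)
  have h1 : k ^ 2 * b ^ 2 ≤ k ^ 2 * n ^ 2 := by gcongr
  have h2 : 0 ≤ (k * (k + 3)) * b ^ 3 := by positivity
  have h3 : 0 ≤ (k ^ 2 - 1) * n ^ 2 := mul_nonneg (by nlinarith) (by positivity)
  have h4 : 0 ≤ (k - 1) * n ^ 2 := mul_nonneg (by linarith) (by positivity)
  have h5 : 0 ≤ n ^ 2 := by positivity
  rw [hM]
  nlinarith

/-- By `hN`, 16 N Lβ = (1/2 - Lβ)/4, so the bracket in Λ is at least ρ/2 and Λ ≥ β/(2L). Then ψ ≤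
128 N Lβ = 1 - 2Lβ. -/
lemma cPsi_bounds {ρ Θ Θ' N : ℝ} (hL : 0 < L) (hβ : 0 < β)
    (hN : L * β * (1 + 64 * N) = 1 / 2) (hρ : 0 < ρ) (hT0 : 0 ≤ Θ + Θ')
    (hT : Θ + Θ' ≤ 16 * N * ρ) :
    0 ≤ cPsi 3 L β ρ Θ Θ' ∧ cPsi 3 L β ρ Θ Θ' ≤ 1 - 2 * (L * β) := by
  set T := Θ + Θ' with hTdef
  have hx : 0 < L * β := by positivity
  have hΛ : β / (2 * L) ≤ cLambda 3 L β ρ Θ Θ' := by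
    have h1 : T * (L * β) ≤ 16 * N * ρ * (L * β) := by gcongr
    have e : 16 * N * ρ * (L * β) = ρ * (1 / 2 - L * β) / 4 := by rw [← hN]; ring
    have h2 : ρ / 2 ≤ ρ - (ρ + (3 + 1) * T) * L * β := by linarith
    have e2 : β / (2 * L) = 4 * β * (ρ / 2) / (L * ρ * (3 + 1)) := by field_simp; ring
    rw [cLambda, ← hTdef, e2]
    gcongr
  have hΛ0 : 0 < cLambda 3 L β ρ Θ Θ' := lt_of_lt_of_le (by positivity) hΛ
  rw [cPsi, ← hTdef]
  refine ⟨by positivity, ?_⟩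
  calc 4 * β ^ 2 * T / (ρ * cLambda 3 L β ρ Θ Θ')
      ≤ 4 * β ^ 2 * (16 * N * ρ) / (ρ * (β / (2 * L))) := by
        have : 0 ≤ 16 * N * ρ := hT0.trans hT
        gcongr
    _ = 128 * N * (L * β) := by field_simp; ring
    _ = _ := by linarith

lemma C2_C3_bounds {ρ Θ Θ' : ℝ} (hx : 0 ≤ L * β) (hx' : L * β ≤ 1 / 2)
    (h0 : 0 ≤ cPsi 3 L β ρ Θ Θ') (h1 : cPsi 3 L β ρ Θ Θ' ≤ 1 - 2 * (L * β)) :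
    (100 ≤ C2 3 L β ρ Θ Θ' ∧ C2 3 L β ρ Θ Θ' ≤ 2559) ∧
      (120 ≤ C3 3 L β ρ Θ Θ' ∧ C3 3 L β ρ Θ Θ' ≤ 3636) := by
  simp only [C3, C2, C1, C0]
  set ψ := cPsi 3 L β ρ Θ Θ'
  have e : ∀ c : ℝ, c * L ^ 2 * β ^ 2 = c * (L * β) ^ 2 := fun c => by ring
  simp only [e]
  set x := L * β
  have hx2 : 0 ≤ x ^ 2 := by positivity
  have hxq : x ^ 2 ≤ x / 2 := by nlinarith
  have hxc : x ^ 3 ≥ 0 := by positivity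
  have hψ : ψ * x ^ 2 ≤ (1 - 2 * x) * x ^ 2 := by gcongr
  have hψ0 : 0 ≤ ψ * x ^ 2 := by positivity
  refine ⟨⟨?_, ?_⟩, ?_, ?_⟩ <;> ring_nf at * <;> nlinarith

end Constants

/-! ### Rates of the method -/

lemma rpow_two_thirds_pow_three (n : ℕ) : ((n : ℝ) ^ (2 / 3 : ℝ)) ^ 3 = (n : ℝ) ^ 2 := by
  rw [← Real.rpow_natCast, ← Real.rpow_mul (Nat.cast_nonneg n)]
  norm_num

lemma saga_parameters {b : ℕ} (hb : 1 ≤ b) (hbn : b ≤ n) :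
    0 < sagaRho n b ∧ 0 ≤ sagaTheta n b + sagaTheta' n b ∧
      sagaTheta n b + sagaTheta' n b ≤ 16 * ((n : ℝ) ^ 2 / (b : ℝ) ^ 3) * sagaRho n b := by
  have hb0 : (0 : ℝ) < b := by exact_mod_cast hb
  have hbn' : (b : ℝ) ≤ n := by exact_mod_cast hbn
  have hn0 : (0 : ℝ) < n := hb0.trans_le hbn'
  have hnb : (0 : ℝ) ≤ n - b := by linarith
  refine ⟨by unfold sagaRho; positivity, by unfold sagaTheta sagaTheta'; positivity, ?_⟩
  have e : 16 * ((n : ℝ) ^ 2 / (b : ℝ) ^ 3) * sagaRho n b = 8 * n ^ 2 / (n * (b : ℝ) ^ 2) := by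
    unfold sagaRho; field_simp; ring
  rw [e, sagaTheta, sagaTheta', ← add_div]
  gcongr
  nlinarith

section Rates

variable {Ω : Type*} [MeasurableSpace Ω] {μ : Measure Ω} [IsProbabilityMeasure μ] {b : ℕ}
  {G : Fin n → EuclideanSpace ℝ (Fin p) → EuclideanSpace ℝ (Fin p)} {L β : ℝ}
  {x0 xs : EuclideanSpace ℝ (Fin p)} {A B : ℕ → Ω → Finset (Fin n)}

omit [MeasurableSpace Ω] in
lemma energy_zero (G : Fin n → EuclideanSpace ℝ (Fin p) → EuclideanSpace ℝ (Fin p)) (ω : Ω) :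
    (process G β x0 A B 0 ω).energy G β xs 0 = 4 * ‖x0 - xs‖ ^ 2 := by
  have h : (process G β x0 A B 0 ω).cur = x0 := rfl
  rw [State.energy, energy, h, Nat.cast_zero, zero_smul, add_zero, norm_smul, Real.norm_ofNat]
  ring

/-- The energy is bounded in expectation, and the weighted increments vanish. -/
lemma process_rates (hS : Sampling μ b A B) (hb : 1 ≤ b) (hbn : b ≤ n) (hL : 0 < L)
    (hG : AvgCocoercive G L) (hxs : avg G xs = 0)
    (hβ : β = (b : ℝ) ^ 3 / (2 * L * ((b : ℝ) ^ 3 + 64 * (n : ℝ) ^ 2))) :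
    (∀ k, ∫ ω, (process G β x0 A B k ω).energy G β xs k ∂μ ≤ 4 * ‖x0 - xs‖ ^ 2) ∧
      Tendsto (fun k : ℕ => (k : ℝ) ^ 2 * ∫ ω, (process G β x0 A B k ω).incrSq ∂μ)
        atTop (𝓝 0) ∧
      Tendsto (fun k : ℕ => (k : ℝ) ^ 2 * ∫ ω, (process G β x0 A B k ω).resSq G β ∂μ)
        atTop (𝓝 0) := by
  have hb0 : (0 : ℝ) < b := by exact_mod_cast hb
  have hbn' : (b : ℝ) ≤ n := by exact_mod_cast hbn
  have hn0 : (0 : ℝ) < n := hb0.trans_le hbn'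
  obtain ⟨hβ0, -, hβL⟩ := step_size_identity hb0 hn0 hL hβ
  have h0c : ∀ ω, (process G β x0 A B 0 ω).cur = x0 := fun _ => rfl
  have h0p : ∀ ω, (process G β x0 A B 0 ω).prev = x0 := fun _ => rfl
  have h0t : ∀ ω, (process G β x0 A B 0 ω).table = fun i => G i x0 := fun _ => rfl
  have hrates := rates_of_step
    (e := fun k => ∫ ω, (process G β x0 A B k ω).energy G β xs k ∂μ)
    (d := fun k => ∫ ω, (process G β x0 A B k ω).incrSq ∂μ)
    (q := fun k => ∫ ω, (process G β x0 A B k ω).resSq G β ∂μ)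
    (U := fun k => ∫ ω, compDist G (process G β x0 A B k ω).cur (process G β x0 A B k ω).prev ∂μ)
    (V := fun k => ∫ ω, tableError G (process G β x0 A B k ω) ∂μ)
    (a := (b : ℝ) / n) (κ := β * (1 / L - β)) (δ := β / (8 * L)) (c := 6 * β ^ 2)
    (c' := 4 * β ^ 2) (m := 1 / b)
    (fun k => integral_nonneg fun ω => by simp only [State.energy, energy]; positivity)
    (fun k => integral_nonneg fun ω => by simp only [State.incrSq]; positivity)
    (fun k => integral_nonneg fun ω => by simp only [State.resSq]; positivity)
    (fun k => integral_nonneg fun ω => compDist_nonneg _ _)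
    (fun k => integral_nonneg fun ω => tableError_nonneg _)
    (by simp [compDist, h0c, h0p]) (by simp [tableError, h0c, h0t])
    (by positivity) ((div_le_one hn0).2 hbn') (by positivity) (by positivity) (by positivity)
    (by positivity)
    (integral_energy_succ_le hS hb hbn hG hxs hβ0.le hβL)
    (integral_tableError_succ_le hS hb hbn)
    (fun k hk => noise_coefficient_le hb0 hbn' hL hβ (by exact_mod_cast hk))
    (integral_incrSq_succ_le hS hb hbn hG hβ0.le hβL)
    (integral_resSq_succ_le hS hb hbn)
  refine ⟨fun k => (hrates.1 k).trans_eq ?_, hrates.2⟩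
  simp only [energy_zero, integral_const, probReal_univ, one_smul]

/-- The energy at k+1 yields 16/((k+1)(k+4)), and (k+5)²/((k+1)(k+4)) is largest at k = 0, where it
is 25/4; hence 100. -/
lemma integral_increment_le (hS : Sampling μ b A B)
    (hE : ∀ k, ∫ ω, (process G β x0 A B k ω).energy G β xs k ∂μ ≤ 4 * ‖x0 - xs‖ ^ 2) (k : ℕ) :
    ∫ ω, (process G β x0 A B (k + 1) ω).incrSq ∂μ
      ≤ 100 * ‖x0 - xs‖ ^ 2 / ((k : ℝ) + 5) ^ 2 := by
  have h1 : ((k + 1 : ℕ) : ℝ) * ((k + 1 : ℕ) + 3) *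
      ∫ ω, (process G β x0 A B (k + 1) ω).incrSq ∂μ ≤ 4 * (4 * ‖x0 - xs‖ ^ 2) := by
    rw [← integral_const_mul]
    refine le_trans ?_ (mul_le_mul_of_nonneg_left (hE (k + 1)) (by norm_num))
    rw [← integral_const_mul]
    exact integral_mono
      (integrable_process hS (k + 1) fun σ => ((k + 1 : ℕ) : ℝ) * ((k + 1 : ℕ) + 3) * σ.incrSq)
      (integrable_process hS (k + 1) fun σ => 4 * σ.energy G β xs (k + 1))
      fun ω => increment_le_energy
  have h0 : 0 ≤ ∫ ω, (process G β x0 A B (k + 1) ω).incrSq ∂μ :=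
    integral_nonneg fun ω => by simp only [State.incrSq]; positivity
  set d := ∫ ω, (process G β x0 A B (k + 1) ω).incrSq ∂μ
  rw [le_div_iff₀ (by positivity)]
  push_cast at h1
  have hk : (0 : ℝ) ≤ k := Nat.cast_nonneg k
  have h2 : 0 ≤ d * (k ^ 2) := by positivity
  have h3 : 0 ≤ d * k := by positivity
  nlinarith

/-- Gx^k enters the energy at k+1, which yields 12/(β²(k+1)²); since (k+2)(k+5) ≤ 10(k+1)², the
constant is 120. -/
lemma integral_operator_le (hS : Sampling μ b A B) (hβ : 0 < β)
    (hE : ∀ k, ∫ ω, (process G β x0 A B k ω).energy G β xs k ∂μ ≤ 4 * ‖x0 - xs‖ ^ 2) (k : ℕ) :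
    ∫ ω, ‖avg G (process G β x0 A B k ω).cur‖ ^ 2 ∂μ
      ≤ 120 * ‖x0 - xs‖ ^ 2 / (β ^ 2 * ((k : ℝ) + 2) * ((k : ℝ) + 5)) := by
  have hp : ∀ ω, (process G β x0 A B (k + 1) ω).prev = (process G β x0 A B k ω).cur :=
    fun _ => rfl
  have h1 : ((k + 1 : ℕ) : ℝ) ^ 2 * (2 * β) ^ 2 *
      ∫ ω, ‖avg G (process G β x0 A B k ω).cur‖ ^ 2 ∂μ ≤ 12 * (4 * ‖x0 - xs‖ ^ 2) := by
    rw [← integral_const_mul]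
    refine le_trans ?_ (mul_le_mul_of_nonneg_left (hE (k + 1)) (by norm_num))
    rw [← integral_const_mul]
    refine integral_mono (integrable_process hS k fun σ =>
        ((k + 1 : ℕ) : ℝ) ^ 2 * (2 * β) ^ 2 * ‖avg G σ.cur‖ ^ 2)
      (integrable_process hS (k + 1) fun σ => 12 * σ.energy G β xs (k + 1)) fun ω => ?_
    simp only [← hp ω]
    exact operator_le_energy
  have h0 : 0 ≤ ∫ ω, ‖avg G (process G β x0 A B k ω).cur‖ ^ 2 ∂μ :=
    integral_nonneg fun ω => by positivity
  set g := ∫ ω, ‖avg G (process G β x0 A B k ω).cur‖ ^ 2 ∂μ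
  rw [le_div_iff₀ (by positivity)]
  push_cast at h1
  have h2 : 0 ≤ g * β ^ 2 * (k : ℝ) ^ 2 := by positivity
  have h3 : 0 ≤ g * β ^ 2 * (k : ℝ) := by positivity
  nlinarith

omit [IsProbabilityMeasure μ] in
lemma tendsto_sq_mul_integral_increment
    (hd : Tendsto (fun k : ℕ => (k : ℝ) ^ 2 * ∫ ω, (process G β x0 A B k ω).incrSq ∂μ)
      atTop (𝓝 0)) :
    Tendsto (fun k : ℕ => (k : ℝ) ^ 2 * ∫ ω, (process G β x0 A B (k + 1) ω).incrSq ∂μ)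
      atTop (𝓝 0) := by
  have h0 : ∀ k, 0 ≤ ∫ ω, (process G β x0 A B k ω).incrSq ∂μ := fun k =>
    integral_nonneg fun ω => by simp only [State.incrSq]; positivity
  refine squeeze_zero (fun k => mul_nonneg (by positivity) (h0 _)) (fun k => ?_)
    ((tendsto_add_atTop_iff_nat 1).2 hd)
  refine mul_le_mul_of_nonneg_right ?_ (h0 _)
  push_cast
  gcongr
  linarith

lemma tendsto_sq_mul_integral_operator (hS : Sampling μ b A B) (hβ : 0 < β)
    (hd : Tendsto (fun k : ℕ => (k : ℝ) ^ 2 * ∫ ω, (process G β x0 A B k ω).incrSq ∂μ)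
      atTop (𝓝 0))
    (hq : Tendsto (fun k : ℕ => (k : ℝ) ^ 2 * ∫ ω, (process G β x0 A B k ω).resSq G β ∂μ)
      atTop (𝓝 0)) :
    Tendsto (fun k : ℕ => (k : ℝ) ^ 2 * ∫ ω, ‖avg G (process G β x0 A B k ω).cur‖ ^ 2 ∂μ)
      atTop (𝓝 0) := by
  have hlim := (((tendsto_add_atTop_iff_nat 1).2 hd).add
    ((tendsto_add_atTop_iff_nat 1).2 hq)).const_mul (1 / (2 * β ^ 2))
  simp only [add_zero, mul_zero] at hlim
  refine squeeze_zero (fun k => mul_nonneg (by positivity)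
    (integral_nonneg fun ω => by positivity)) (fun k => ?_) hlim
  have hp : ∀ ω, (process G β x0 A B (k + 1) ω).prev = (process G β x0 A B k ω).cur :=
    fun _ => rfl
  have hi := fun φ => integrable_process (G := G) (β := β) (x0 := x0) hS (k + 1) φ
  have h1 : ∫ ω, ‖avg G (process G β x0 A B k ω).cur‖ ^ 2 ∂μ ≤ 1 / (2 * β ^ 2) *
      (∫ ω, (process G β x0 A B (k + 1) ω).incrSq ∂μ
        + ∫ ω, (process G β x0 A B (k + 1) ω).resSq G β ∂μ) := by
    rw [← integral_add (hi State.incrSq) (hi (State.resSq G β)), ← integral_const_mul]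
    refine integral_mono (integrable_process hS k fun σ => ‖avg G σ.cur‖ ^ 2)
      (hi fun σ => 1 / (2 * β ^ 2) * (σ.incrSq + σ.resSq G β)) fun ω => ?_
    simp only [State.incrSq, State.resSq, ← hp ω]
    set D := (process G β x0 A B (k + 1) ω).cur - (process G β x0 A B (k + 1) ω).prev
    set g := avg G (process G β x0 A B (k + 1) ω).prev
    have e1 : (2 * β) * ‖g‖ = ‖(D + (2 * β) • g) - D‖ := by
      rw [add_sub_cancel_left, norm_smul, Real.norm_of_nonneg (by positivity)]
    have e2 : (2 * β) * ‖g‖ ≤ ‖D + (2 * β) • g‖ + ‖D‖ := e1.trans_le (norm_sub_le _ _)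
    have e3 : ((2 * β) * ‖g‖) ^ 2 ≤ (‖D + (2 * β) • g‖ + ‖D‖) ^ 2 := by gcongr
    rw [one_div_mul_eq_div, le_div_iff₀ (by positivity)]
    nlinarith [sq_nonneg (‖D + (2 * β) • g‖ - ‖D‖)]
  have hsum : 0 ≤ ∫ ω, (process G β x0 A B (k + 1) ω).incrSq ∂μ
      + ∫ ω, (process G β x0 A B (k + 1) ω).resSq G β ∂μ :=
    add_nonneg (integral_nonneg fun ω => by simp only [State.incrSq]; positivity)
      (integral_nonneg fun ω => by simp only [State.resSq]; positivity)
  calc (k : ℝ) ^ 2 * ∫ ω, ‖avg G (process G β x0 A B k ω).cur‖ ^ 2 ∂μ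
      ≤ ((k + 1 : ℕ) : ℝ) ^ 2 * (1 / (2 * β ^ 2) *
        (∫ ω, (process G β x0 A B (k + 1) ω).incrSq ∂μ
          + ∫ ω, (process G β x0 A B (k + 1) ω).resSq G β ∂μ)) := by
        gcongr
        omega
    _ = _ := by ring

end Rates

/-! ### Range of the step size and oracle complexity. -/

lemma step_size_range {b n L β : ℝ} (hb : 1 ≤ b) (hn : 0 < n) (hL : 0 < L)
    (hb3 : b ^ 3 ≤ 4096 * n ^ 2) (hβ : β = b ^ 3 / (2 * L * (b ^ 3 + 64 * n ^ 2))) :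
    1 / (2 * L * (1 + 64 * n ^ 2)) ≤ β ∧ β ≤ 32 / (65 * L) ∧
      (b ^ 3 ≤ 64 * n ^ 2 → β ≤ 1 / (4 * L)) := by
  have hb0 : 0 < b := by linarith
  have h1 : 1 ≤ b ^ 3 := one_le_pow₀ hb
  have h0 : 0 < b ^ 3 + 64 * n ^ 2 := by positivity
  have h2 : 0 < n ^ 2 := by positivity
  rw [hβ]
  refine ⟨?_, ?_, fun h => ?_⟩ <;> rw [div_le_div_iff₀ (by positivity) (by positivity)]
  · have : 0 ≤ L * ((b ^ 3 - 1) * n ^ 2) :=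
      mul_nonneg hL.le (mul_nonneg (by linarith) h2.le)
    linarith
  · have : 0 ≤ L * (4096 * n ^ 2 - b ^ 3) := mul_nonneg hL.le (by linarith)
    linarith
  · have : 0 ≤ L * (64 * n ^ 2 - b ^ 3) := mul_nonneg hL.le (by linarith)
    linarith

lemma inv_step_size_le {b n L β c : ℝ} (hb : 0 < b) (hL : 0 < L) (hc : 0 < c)
    (hcb : c ^ 3 * n ^ 2 ≤ b ^ 3) (hβ : β = b ^ 3 / (2 * L * (b ^ 3 + 64 * n ^ 2))) :
    1 / β ≤ L * (2 * (c ^ 3 + 64) / c ^ 3) := by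
  rw [hβ, one_div_div, ← mul_div_assoc, div_le_div_iff₀ (by positivity) (by positivity)]
  have : 0 ≤ L * (b ^ 3 - c ^ 3 * n ^ 2) := mul_nonneg hL.le (by linarith)
  linarith

lemma oracleCalls_le {A B : ℕ → Finset (Fin n)} {b : ℕ} (hA : ∀ k, (A k).card = b)
    (hB : ∀ k, (B k).card = b) (K : ℕ) : oracleCalls A B K ≤ n + 3 * b * K := by
  unfold oracleCalls
  gcongr
  calc ∑ j ∈ Icc 1 K, ((A j ∪ B j).card + (B j).card) ≤ ∑ j ∈ Icc 1 K, 3 * b := by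
        refine sum_le_sum fun j _ => ?_
        have := card_union_le (A j) (B j)
        rw [hA, hB] at this
        rw [hB]
        omega
    _ = 3 * b * K := by simp [mul_comm]

/-- The factor 11 serves because 11² = 121 ≥ 120. -/
lemma operator_le_sq_of_large {g D β ε : ℝ} {K k : ℕ} (hβ : 0 < β) (hε : 0 < ε) (hD : 0 ≤ D)
    (hg : g ≤ 120 * D ^ 2 / (β ^ 2 * ((k : ℝ) + 2) * ((k : ℝ) + 5)))
    (hK : 11 * D / (β * ε) ≤ K) (hk : K ≤ k) : g ≤ ε ^ 2 := by
  refine hg.trans ?_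
  have hk' : (K : ℝ) ≤ k := by exact_mod_cast hk
  rw [div_le_iff₀ (by positivity)] at hK
  rw [div_le_iff₀ (by positivity)]
  have h1 : 11 * D ≤ k * (β * ε) := hK.trans (by gcongr)
  have h2 : (11 * D) ^ 2 ≤ (k * (β * ε)) ^ 2 := by gcongr
  have h3 : 0 ≤ (β * ε) ^ 2 := by positivity
  have h4 : 0 ≤ (β * ε) ^ 2 * k := by positivity
  have h5 : 0 ≤ D ^ 2 := by positivity
  linarith

/-- Here 528 = 3·16·11: at most 3b calls per iteration, b ≤ 16N, and 11 from K. Rounding K up costs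
3b ≤ 3n, whence 4 = 1 + 3. -/
lemma calls_bound {n b K D L β ε c N : ℝ} (hN : 0 ≤ N) (hbn : b ≤ n) (hb : 0 ≤ b)
    (hb16 : b ≤ 16 * N) (hβ : 0 < β) (hε : 0 < ε) (hD : 0 ≤ D) (hL : 0 ≤ L) (hc : 0 < c)
    (hβc : 1 / β ≤ L * (2 * (c ^ 3 + 64) / c ^ 3)) (hK : K ≤ 11 * D / (β * ε) + 1) :
    n + 3 * b * K ≤ (4 + 528 * (2 * (c ^ 3 + 64) / c ^ 3)) * (n + N * L * D / ε) := by
  set κ := 2 * (c ^ 3 + 64) / c ^ 3 with hκ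
  have hκ0 : 0 ≤ κ := by positivity
  have hn : 0 ≤ n := hb.trans hbn
  have h1 : 11 * D / (β * ε) ≤ 11 * (L * κ) * D / ε := by
    calc 11 * D / (β * ε) = 11 * (1 / β) * D / ε := by field_simp
      _ ≤ _ := by gcongr
  have h2 : 3 * b * K ≤ 3 * b * (11 * (L * κ) * D / ε) + 3 * b := by
    have := mul_le_mul_of_nonneg_left (hK.trans (add_le_add_left h1 1))
      (by positivity : 0 ≤ 3 * b)
    linarith
  have h3 : 3 * b * (11 * (L * κ) * D / ε) ≤ 3 * (16 * N) * (11 * (L * κ) * D / ε) := by gcongr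
  have h4 : 3 * (16 * N) * (11 * (L * κ) * D / ε) = 528 * κ * (N * L * D / ε) := by ring
  have h5 : 0 ≤ N * L * D / ε := by positivity
  have h6 : 0 ≤ κ * n := by positivity
  linarith

end VFKM

theorem mainTheorem6 :
    -- `C c` depends only on `c`, the constant in `b ≥ c n^{2/3}`
    ∃ C : ℝ → ℝ,
    ∀ (n p b : ℕ) (G : Fin n → EuclideanSpace ℝ (Fin p) → EuclideanSpace ℝ (Fin p))
      (L β : ℝ) (x0 xs : EuclideanSpace ℝ (Fin p))
      (Ω : Type*) [MeasurableSpace Ω] (μ : MeasureTheory.Measure Ω)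
      [MeasureTheory.IsProbabilityMeasure μ]
      (A B : ℕ → Ω → Finset (Fin n)) (x : ℕ → Ω → EuclideanSpace ℝ (Fin p)) (c2 c3 : ℝ),
    1 ≤ b → b ≤ n → (b : ℝ) ≤ 16 * (n : ℝ) ^ (2 / 3 : ℝ) →
    0 < L → VFKM.AvgCocoercive G L → VFKM.avg G xs = 0 →
    β = (b : ℝ) ^ 3 / (2 * L * ((b : ℝ) ^ 3 + 64 * (n : ℝ) ^ 2)) →
    VFKM.Sampling μ b A B →
    (∀ k ω, x k ω = VFKM.iter G 3 β x0 (fun j => A j ω) (fun j => B j ω) k) →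
    c2 = VFKM.C2 3 L β (VFKM.sagaRho n b) (VFKM.sagaTheta n b) (VFKM.sagaTheta' n b) →
    c3 = VFKM.C3 3 L β (VFKM.sagaRho n b) (VFKM.sagaTheta n b) (VFKM.sagaTheta' n b) →
    -- the range of the step size
    (1 / (2 * L * (1 + 64 * (n : ℝ) ^ 2)) ≤ β ∧ β ≤ 32 / (65 * L) ∧
      ((b : ℝ) ≤ 4 * (n : ℝ) ^ (2 / 3 : ℝ) → β ≤ 1 / (4 * L))) ∧
    -- the constants
    (c2 ≤ 2559 ∧ c3 ≤ 3636) ∧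
    -- the expectations are those of integrable functions
    (∀ k, MeasureTheory.Integrable (fun ω => ‖x (k + 1) ω - x k ω‖ ^ 2) μ ∧
      MeasureTheory.Integrable (fun ω => ‖VFKM.avg G (x k ω)‖ ^ 2) μ) ∧
    -- the `O(1/k²)` rates
    (∀ k : ℕ, ∫ ω, ‖x (k + 1) ω - x k ω‖ ^ 2 ∂μ ≤
      c2 * ‖x0 - xs‖ ^ 2 / ((k : ℝ) + 3 + 2) ^ 2) ∧
    (∀ k : ℕ, ∫ ω, ‖VFKM.avg G (x k ω)‖ ^ 2 ∂μ ≤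
      c3 * ‖x0 - xs‖ ^ 2 / (β ^ 2 * ((k : ℝ) + 3 - 1) * ((k : ℝ) + 3 + 2))) ∧
    -- the `o(1/k²)` rates
    Filter.Tendsto (fun k : ℕ => (k : ℝ) ^ 2 * ∫ ω, ‖x (k + 1) ω - x k ω‖ ^ 2 ∂μ)
      Filter.atTop (nhds 0) ∧
    Filter.Tendsto (fun k : ℕ => (k : ℝ) ^ 2 * ∫ ω, ‖VFKM.avg G (x k ω)‖ ^ 2 ∂μ)
      Filter.atTop (nhds 0) ∧
    -- the oracle complexity for batch sizes of order `n^{2/3}`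
    (∀ c : ℝ, 0 < c → c * (n : ℝ) ^ (2 / 3 : ℝ) ≤ b → ∀ ε : ℝ, 0 < ε →
      ∃ K : ℕ, (∀ k ≥ K, ∫ ω, ‖VFKM.avg G (x k ω)‖ ^ 2 ∂μ ≤ ε ^ 2) ∧
        ∀ᵐ ω ∂μ, (VFKM.oracleCalls (fun j => A j ω) (fun j => B j ω) K : ℝ) ≤
          C c * (n + (n : ℝ) ^ (2 / 3 : ℝ) * L * ‖x0 - xs‖ / ε)) := by
  refine ⟨fun c => 4 + 528 * (2 * (c ^ 3 + 64) / c ^ 3), ?_⟩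
  intro n p b G L β x0 xs Ω _ μ _ A B x c2 c3 hb hbn hb16 hL hG hxs hβ hS hx hc2 hc3
  have hb1 : (1 : ℝ) ≤ b := by exact_mod_cast hb
  have hb0 : (0 : ℝ) < b := by linarith
  have hbn' : (b : ℝ) ≤ n := by exact_mod_cast hbn
  have hn0 : (0 : ℝ) < n := hb0.trans_le hbn'
  have hpow : ∀ c : ℝ, (c * (n : ℝ) ^ (2 / 3 : ℝ)) ^ 3 = c ^ 3 * (n : ℝ) ^ 2 := fun c => by
    rw [mul_pow, VFKM.rpow_two_thirds_pow_three]
  have hb3 : (b : ℝ) ^ 3 ≤ 4096 * (n : ℝ) ^ 2 := by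
    have h : (b : ℝ) ^ 3 ≤ (16 * (n : ℝ) ^ (2 / 3 : ℝ)) ^ 3 := by gcongr
    rw [hpow] at h
    norm_num at h ⊢
    exact h
  obtain ⟨hβ0, hN, hβL⟩ := VFKM.step_size_identity hb0 hn0 hL hβ
  obtain ⟨hr1, hr2, hr3⟩ := VFKM.step_size_range hb1 hn0 hL hb3 hβ
  obtain ⟨hρ, hT0, hT⟩ := VFKM.saga_parameters hb hbn
  obtain ⟨hψ0, hψ1⟩ := VFKM.cPsi_bounds hL hβ0 hN hρ hT0 hT
  have hx0 : 0 ≤ L * β := by positivity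
  have hx1 : L * β ≤ 1 / 2 := by
    have : 0 ≤ L * β * (64 * ((n : ℝ) ^ 2 / (b : ℝ) ^ 3)) := by positivity
    linarith
  obtain ⟨⟨hc2l, hc2u⟩, hc3l, hc3u⟩ := VFKM.C2_C3_bounds hx0 hx1 hψ0 hψ1
  rw [← hc2] at hc2l hc2u
  rw [← hc3] at hc3l hc3u
  obtain ⟨hE, hd, hq⟩ := VFKM.process_rates (x0 := x0) hS hb hbn hL hG hxs hβ
  have hxp : ∀ k ω, x k ω = (VFKM.process G β x0 A B k ω).cur := hx
  have hincr : ∀ k ω, ‖x (k + 1) ω - x k ω‖ ^ 2 = (VFKM.process G β x0 A B (k + 1) ω).incrSq :=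
    fun k ω => by rw [hxp, hxp]; rfl
  have hop := VFKM.integral_operator_le hS hβ0 hE
  simp only [hincr]
  simp only [hxp]
  refine ⟨⟨hr1, hr2, fun h => hr3 ?_⟩, ⟨hc2u, hc3u⟩, fun k => ⟨?_, ?_⟩, fun k => ?_, fun k => ?_,
    VFKM.tendsto_sq_mul_integral_increment hd,
    VFKM.tendsto_sq_mul_integral_operator hS hβ0 hd hq, ?_⟩
  · have h' : (b : ℝ) ^ 3 ≤ (4 * (n : ℝ) ^ (2 / 3 : ℝ)) ^ 3 := by gcongr
    rw [hpow] at h'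
    norm_num at h' ⊢
    exact h'
  · exact VFKM.integrable_process hS (k + 1) VFKM.State.incrSq
  · exact VFKM.integrable_process hS k fun σ => ‖VFKM.avg G σ.cur‖ ^ 2
  · refine (VFKM.integral_increment_le hS hE k).trans ?_
    rw [show (k : ℝ) + 3 + 2 = k + 5 by ring]
    gcongr
  · refine (hop k).trans ?_
    rw [show (k : ℝ) + 3 + 2 = k + 5 by ring, show (k : ℝ) + 3 - 1 = k + 2 by ring]
    gcongr
  · intro c hc hcb ε hε
    refine ⟨⌈11 * ‖x0 - xs‖ / (β * ε)⌉₊, fun k hk => VFKM.operator_le_sq_of_large hβ0 hε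
      (norm_nonneg _) (hop k) (Nat.le_ceil _) hk, ?_⟩
    have hcb3 : c ^ 3 * (n : ℝ) ^ 2 ≤ (b : ℝ) ^ 3 := by
      rw [← hpow]
      gcongr
    filter_upwards [MeasureTheory.ae_all_iff.2 fun k =>
        VFKM.ae_card_eq_of_uniform hbn (hS.measurable_A k) (hS.uniform_A k),
      MeasureTheory.ae_all_iff.2 fun k =>
        VFKM.ae_card_eq_of_uniform hbn (hS.measurable_B k) (hS.uniform_B k)] with ω hA hB
    have h1 := VFKM.oracleCalls_le hA hB ⌈11 * ‖x0 - xs‖ / (β * ε)⌉₊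
    refine (Nat.cast_le (α := ℝ).2 h1).trans ?_
    push_cast
    exact VFKM.calls_bound (by positivity) hbn' hb0.le hb16 hβ0 hε (norm_nonneg _) hL.le hc
      (VFKM.inv_step_size_le hb0 hL hc hcb3 hβ) (Nat.ceil_lt_add_one (by positivity)).le
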